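/- For integers $n\ge 0$ and $0\le m\le\binom n2$ let $G(n,m)$ be uniformly distributed over the simple graphs on $n$ labelled vertices with exactly $m$ edges, and let $\vec G(n,m)$ be the random directed graph obtained from $G(n,m)$ by giving each edge one of its two directions, each with probability $\tfrac12$, independently for different edges. For vertices $u,v$ write $u\not\to v$ for the event that $\vec G(n,m)$ contains no directed path from $u$ to $v$, and for events $A,B$ put $\operatorname{Cov}(A,B)=\mathbb P(A\cap B)-\mathbb P(A)\,\mathbb P(B)$, where $\mathbb P$ refers to the joint randomness of graph and orientation. **Theorem.** The equation $3e^{-2p(1-p)/(2-p)^2}=4-2p$ has a unique root $p_c$ in $[0,1]$; it lies in $(0,1)$ and $p_c\approx 0.7993$ (correct to four decimals). Let $m=m(n)$ be integers with $0\le m(n)\le\binom n2$ such that $m(n)/\binom n2\to p\in(0,1]$ as $n\to\infty$. Then for all sufficiently large $n$ and all distinct vertices $s,a,b$ of $\vec G(n,m)$: 1. if $0<p<p_c$, then $\operatorname{Cov}(s\not\to a,\ b\not\to s)<0$; 2. if $p_c<p\le 1$, then $\operatorname{Cov}(s\not\to a,\ b\not\to s)>0$. -/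

import Mathlib

namespace RandomOrientation

/-- There are graphs on `n` labelled vertices with exactly `m` edges whenever `m ≤ n.choose 2`. -/
theorem exists_graph (n m : ℕ) (h : m ≤ n.choose 2) :
    ∃ G : SimpleGraph (Fin n), G.edgeSet.ncard = m := by
  classical
  have hc : (⊤ : SimpleGraph (Fin n)).edgeFinset.card = n.choose 2 := by
    rw [SimpleGraph.card_edgeFinset_top_eq_card_choose_two, Fintype.card_fin]
  obtain ⟨E, hE, hEm⟩ := Finset.exists_subset_card_eq (hc ▸ h)
  refine ⟨SimpleGraph.fromEdgeSet (E : Set (Sym2 (Fin n))), ?_⟩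
  have hd : (SimpleGraph.fromEdgeSet (E : Set (Sym2 (Fin n)))).edgeSet = E := by
    rw [SimpleGraph.edgeSet_fromEdgeSet]
    ext e
    simp only [Set.mem_sdiff, and_iff_left_iff_imp]
    intro he hdiag
    have h1 := hE he
    rw [SimpleGraph.mem_edgeFinset] at h1
    exact SimpleGraph.not_isDiag_of_mem_edgeSet _ h1 hdiag
  rw [hd, Set.ncard_coe_finset, hEm]

open Classical in
/-- The random graph `G(n,m)`: the uniform distribution on the simple graphs with vertex set
`Fin n` that have exactly `m` edges. -/
noncomputable def gnm (n m : ℕ) (h : m ≤ n.choose 2) : PMF (SimpleGraph (Fin n)) :=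
  PMF.uniformOfFinset (Finset.univ.filter fun G : SimpleGraph (Fin n) => G.edgeSet.ncard = m)
    (by
      obtain ⟨G, hG⟩ := exists_graph n m h
      exact ⟨G, by simpa using hG⟩)

/-- The directed graph obtained from `G` by giving each edge `uv`, where `u < v`, the direction
`u → v` if the coin `ω` of the pair `{u, v}` shows `true`, and the direction `v → u` if it shows
`false`. The coins of pairs that are not edges of `G` play no role. -/
def orient {n : ℕ} (G : SimpleGraph (Fin n)) (ω : Sym2 (Fin n) → Bool) : Digraph (Fin n) where
  Adj u v := G.Adj u v ∧ (ω s(u, v) = true ↔ u < v)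

/-- The randomly oriented `G(n,m)` (annealed model): first choose the graph according to `gnm`;
then, given the graph, flip independent fair coins (a uniformly distributed `ω`)
and orient the edges accordingly. -/
noncomputable def orientedGnm (n m : ℕ) (h : m ≤ n.choose 2) : PMF (Digraph (Fin n)) :=
  (gnm n m h).bind fun G =>
    (PMF.uniformOfFintype (Sym2 (Fin n) → Bool)).map (orient G)

/-- The probability of an event, as a real number. -/
noncomputable def prob {Ω : Type*} (P : PMF Ω) (A : Set Ω) : ℝ :=
  (P.toOuterMeasure A).toReal

/-- The covariance of two events, `P(A ∩ B) - P(A) P(B)`. -/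
noncomputable def cov {Ω : Type*} (P : PMF Ω) (A B : Set Ω) : ℝ :=
  prob P (A ∩ B) - prob P A * prob P B

/-- The event `u ↛ v`: there is no directed path from `u` to `v`. -/
def notReach {n : ℕ} (u v : Fin n) : Set (Digraph (Fin n)) :=
  {D | ¬ Relation.ReflTransGen D.Adj u v}

end RandomOrientation

/-! Let `N = n.choose 2`, `r = m / N` and `q = 1 - r / 2`. Non-reachability means that a closed
vertex set separates the two vertices, and closedness costs a factor `1/2` for every edge on the
boundary of the set. Very unbalanced sets therefore dominate: `s ↛ a` happens essentially because no
arc leaves `s` or no arc enters `a`, two cases governed by `n - 1` pairs each. The joint event with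
`b ↛ s` has three main causes: `b` and `s` emit nothing (except possibly `s → b`), or `b` emits and
`a` receives nothing, or `s` and `a` receive nothing (except possibly `a → s`). Each is governed by
`2n - 3` pairs.

These main terms are `E 2^(-X)`, with `X` the number of edges among `k` prescribed pairs.
Independent edges would give `q ^ k`. Fixing the number of edges multiplies this, for `k ~ c n`, by
a factor tending to `exp (-c² p(1-p)/(2-p)²)` (`tendsto_halfProb_div_pow`). Let `α` be this limit
for `c = 1`. Relative to `q ^ (2n)`, the joint probability tends to `3 α⁴ / (1-p/2)³` and the
product of the marginals to `4 α² / (1-p/2)²`, so the sign of the covariance is that of `3 α² - (4 -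
2p)`. A logarithmic form of this comparison is strictly increasing in `p`, which yields the single
threshold.

The error terms are union bounds over colourings. `notReach_eq_separated` and
`notReach_inter_subset` encode the events by colourings that do not increase along arcs.
`prob_separated_le` shows that colourings other than the main ones are negligible, and
`prob_crossing_le` does the same for the remaining case, where `b` reaches `a`. The upper bounds
rest on `es_le_choose_mul_prod`, by which a uniform `m`-set is dominated by independent sampling. -/

namespace RandomOrientation

/-! ### Elementary symmetric sums and domination by independent sampling -/

section Esymm

variable {α : Type*}

/-- The elementary symmetric polynomial of degree `m` in the values of `x` on `S`. -/
def es (S : Finset α) (m : ℕ) (x : α → ℝ) : ℝ :=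
  ∑ M ∈ S.powersetCard m, ∏ e ∈ M, x e

theorem es_zero (S : Finset α) (x : α → ℝ) : es S 0 x = 1 := by
  simp [es]

theorem es_empty_succ (m : ℕ) (x : α → ℝ) : es (∅ : Finset α) (m + 1) x = 0 := by
  rw [es, Finset.powersetCard_eq_empty.2 (by simp), Finset.sum_empty]

theorem es_one (S : Finset α) (m : ℕ) : es S m (fun _ => 1) = S.card.choose m := by
  simp [es]

theorem es_nonneg (S : Finset α) (m : ℕ) (x : α → ℝ) (hx : ∀ e ∈ S, 0 ≤ x e) : 0 ≤ es S m x := by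
  refine Finset.sum_nonneg fun M hM => Finset.prod_nonneg fun e he => hx e ?_
  exact (Finset.mem_powersetCard.1 hM).1 he

theorem es_congr (S : Finset α) (m : ℕ) (x y : α → ℝ) (h : ∀ e ∈ S, x e = y e) :
    es S m x = es S m y := by
  refine Finset.sum_congr rfl fun M hM => Finset.prod_congr rfl fun e he => h e ?_
  exact (Finset.mem_powersetCard.1 hM).1 he

variable [DecidableEq α]

theorem es_insert (S : Finset α) (m : ℕ) (x : α → ℝ) {a : α} (ha : a ∉ S) :
    es (insert a S) (m + 1) x = es S (m + 1) x + x a * es S m x := by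
  unfold es
  rw [Finset.powersetCard_succ_insert ha, Finset.sum_union, Finset.sum_image, Finset.mul_sum]
  · congr 1
    refine Finset.sum_congr rfl fun M hM => ?_
    rw [Finset.prod_insert]
    exact fun h => ha ((Finset.mem_powersetCard.1 hM).1 h)
  · intro M hM M' hM' h
    have h1 : a ∉ M := fun h => ha ((Finset.mem_powersetCard.1 hM).1 h)
    have h2 : a ∉ M' := fun h => ha ((Finset.mem_powersetCard.1 hM').1 h)
    rw [← Finset.erase_insert h1, ← Finset.erase_insert h2, h]
  · rw [Finset.disjoint_left]
    intro M hM hM'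
    obtain ⟨M', _, rfl⟩ := Finset.mem_image.1 hM'
    exact ha ((Finset.mem_powersetCard.1 hM).1 (Finset.mem_insert_self _ _))

theorem es_erase (S : Finset α) (m : ℕ) (x : α → ℝ) {a : α} (ha : a ∈ S) :
    es S (m + 1) x = es (S.erase a) (m + 1) x + x a * es (S.erase a) m x := by
  rw [← es_insert _ _ _ (Finset.notMem_erase a S), Finset.insert_erase ha]

/-- Double counting: each `(m + 1)`-subset arises once from each of its elements. -/
theorem sum_mul_es_erase (S : Finset α) (m : ℕ) (x : α → ℝ) :
    ∑ e ∈ S, x e * es (S.erase e) m x = (m + 1) * es S (m + 1) x := by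
  induction S using Finset.induction_on generalizing m with
  | empty => simp [es_empty_succ]
  | insert a S ha ih =>
    rw [Finset.sum_insert ha, Finset.erase_insert ha, es_insert _ _ _ ha]
    have h : ∀ e ∈ S, (insert a S).erase e = insert a (S.erase e) := fun e he =>
      Finset.erase_insert_of_ne (fun h => ha (h ▸ he))
    have h' : ∀ e ∈ S, a ∉ S.erase e := fun e he h => ha (Finset.mem_of_mem_erase h)
    cases m with
    | zero =>
      have := ih 0
      simp only [es_zero, mul_one] at this ⊢
      rw [this]
      push_cast
      ring
    | succ m =>
      have : ∑ e ∈ S, x e * es ((insert a S).erase e) (m + 1) x =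
          ∑ e ∈ S, x e * es (S.erase e) (m + 1) x + x a * ∑ e ∈ S, x e * es (S.erase e) m x := by
        rw [Finset.mul_sum, ← Finset.sum_add_distrib]
        refine Finset.sum_congr rfl fun e he => ?_
        rw [h e he, es_insert _ _ _ (h' e he)]
        ring
      rw [this, ih, ih]
      push_cast
      ring

/-- An element of the largest possible weight `1` is chosen with at least the average
probability. -/
theorem es_mul_le_card_mul (S : Finset α) (m : ℕ) (x : α → ℝ) (hx : ∀ e ∈ S, 0 ≤ x e ∧ x e ≤ 1)
    {a : α} (ha : a ∈ S) (ha1 : x a = 1) :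
    (m + 1) * es S (m + 1) x ≤ S.card * es (S.erase a) m x := by
  rw [← sum_mul_es_erase, ← nsmul_eq_mul, ← Finset.sum_const]
  -- Termwise comparison: subsets avoiding both `a` and `e` contribute with the factor `x e ≤ 1` on
  -- the left, and the remaining contributions agree because `x a = 1`.
  refine Finset.sum_le_sum fun e he => ?_
  by_cases hea : e = a
  · rw [hea, ha1, one_mul]
  have hae : a ∈ S.erase e := Finset.mem_erase.2 ⟨fun h => hea h.symm, ha⟩
  have hea' : e ∈ S.erase a := Finset.mem_erase.2 ⟨hea, he⟩
  cases m with
  | zero => simpa [es_zero] using (hx e he).2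
  | succ m =>
    rw [es_erase _ _ _ hae, es_erase _ _ _ hea', Finset.erase_right_comm, ha1]
    have h0 : 0 ≤ es ((S.erase a).erase e) (m + 1) x :=
      es_nonneg _ _ _ fun i hi => (hx i (Finset.mem_of_mem_erase (Finset.mem_of_mem_erase hi))).1
    nlinarith [(hx e he).2]

/-- Sampling without replacement is dominated by independent sampling. -/
theorem es_le_choose_mul_prod (S : Finset α) (m : ℕ) (hm : m ≤ S.card) (x : α → ℝ)
    (hx : ∀ e ∈ S, 0 ≤ x e ∧ x e ≤ 1) :
    es S m x ≤ S.card.choose m * ∏ e ∈ S, (1 - (m / S.card : ℝ) * (1 - x e)) := by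
  cases m with
  | zero => simp [es_zero]
  | succ m =>
  set p : ℝ := ((m + 1 : ℕ) : ℝ) / S.card with hp
  have hS : (0 : ℝ) < S.card := by exact_mod_cast (by omega : 0 < S.card)
  have hp0 : 0 ≤ p := by positivity
  have hp1 : p ≤ 1 := by
    rw [hp, div_le_one hS]
    exact_mod_cast hm
  -- All weights start at `1` and are lowered to `x e` one at a time. An element still of weight `1`
  -- is present with probability at least `p`, so lowering it costs at least the factor `1 - p * (1
  -- - x a)`.
  have key : ∀ T : Finset α, T ⊆ S →
      es S (m + 1) (fun e => if e ∈ T then x e else 1) ≤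
        S.card.choose (m + 1) * ∏ e ∈ T, (1 - p * (1 - x e)) := by
    intro T
    induction T using Finset.induction_on with
    | empty => intro _; simp [es_one]
    | insert a T ha ih =>
      intro hT
      have haS : a ∈ S := hT (Finset.mem_insert_self _ _)
      have hTS : T ⊆ S := fun e he => hT (Finset.mem_insert_of_mem he)
      set y : α → ℝ := fun e => if e ∈ T then x e else 1 with hy
      have hy1 : ∀ e ∈ S, 0 ≤ y e ∧ y e ≤ 1 := by
        intro e he
        by_cases h : e ∈ T <;> simp [hy, h, hx e he]
      have hya : y a = 1 := by simp [hy, ha]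
      have hz : ∀ k, es (S.erase a) k (fun e => if e ∈ insert a T then x e else 1) =
          es (S.erase a) k y := by
        intro k
        refine es_congr _ _ _ _ fun e he => ?_
        have : e ≠ a := Finset.ne_of_mem_erase he
        simp [hy, this]
      have h1 := es_erase S m (fun e => if e ∈ insert a T then x e else 1) haS
      have h2 := es_erase S m y haS
      simp only [hz, Finset.mem_insert_self, if_true] at h1
      have h3 := es_mul_le_card_mul S m y hy1 haS hya
      have h4 : p * es S (m + 1) y ≤ es (S.erase a) m y := by
        rw [hp, div_mul_eq_mul_div, div_le_iff₀ hS]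
        push_cast
        linarith
      rw [Finset.prod_insert ha, h1]
      have hxa := hx a haS
      rw [hya] at h2
      have h5 : es (S.erase a) (m + 1) y + x a * es (S.erase a) m y ≤
          (1 - p * (1 - x a)) * es S (m + 1) y := by
        nlinarith
      refine h5.trans ?_
      have h6 : 0 ≤ 1 - p * (1 - x a) := by nlinarith
      calc _ ≤ (1 - p * (1 - x a)) * _ := mul_le_mul_of_nonneg_left (ih hTS) h6
        _ = _ := by ring
  have := key S subset_rfl
  refine le_trans (le_of_eq ?_) this
  exact es_congr _ _ _ _ fun e he => by simp [he]

end Esymm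

/-! ### Generating polynomial for weights `1` and `1/2` -/

section HalfWeights

open Polynomial

/-- The coefficient of `X ^ m` in `(1 + X) ^ a * (1 + X / 2) ^ k`: the total weight of the
`m`-subsets of an `(a + k)`-set in which `k` of the elements have weight `1 / 2`. -/
noncomputable def halfWeight (a k m : ℕ) : ℝ :=
  ((1 + X : ℝ[X]) ^ a * (1 + C (1 / 2 : ℝ) * X) ^ k).coeff m

theorem coeff_one_add_mul (c : ℝ) (P : ℝ[X]) (m : ℕ) :
    ((1 + C c * X) * P).coeff (m + 1) = P.coeff (m + 1) + c * P.coeff m := by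
  rw [add_mul, one_mul, mul_assoc, coeff_add, coeff_C_mul, coeff_X_mul]

theorem es_eq_coeff {α : Type*} [DecidableEq α] (S : Finset α) (m : ℕ) (x : α → ℝ) :
    es S m x = (∏ e ∈ S, (1 + C (x e) * X)).coeff m := by
  induction S using Finset.induction_on generalizing m with
  | empty => cases m <;> simp [es_zero, es_empty_succ, coeff_one]
  | insert a S ha ih =>
    rw [Finset.prod_insert ha]
    cases m with
    | zero =>
      have := ih 0
      rw [es_zero] at this ⊢
      rw [mul_coeff_zero, ← this]
      simp
    | succ m => rw [coeff_one_add_mul, es_insert _ _ _ ha, ih, ih]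

theorem es_eq_halfWeight {α : Type*} [DecidableEq α] (S K : Finset α) (hK : K ⊆ S) (m : ℕ)
    (x : α → ℝ) (h1 : ∀ e ∈ K, x e = 1) (h2 : ∀ e ∈ S \ K, x e = 1 / 2) :
    es S m x = halfWeight K.card (S.card - K.card) m := by
  rw [es_eq_coeff, halfWeight, ← Finset.prod_sdiff hK, mul_comm, ← Finset.card_sdiff_of_subset hK]
  congr 2
  · rw [Finset.prod_congr rfl (g := fun _ => (1 + X : ℝ[X])), Finset.prod_const]
    intro e he
    simp [h1 e he]
  · rw [Finset.prod_congr rfl (g := fun _ => 1 + C (1 / 2 : ℝ) * X), Finset.prod_const]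
    intro e he
    rw [h2 e he]

theorem halfWeight_succ_left (a k m : ℕ) :
    halfWeight (a + 1) k (m + 1) = halfWeight a k (m + 1) + halfWeight a k m := by
  unfold halfWeight
  have := coeff_one_add_mul 1 ((1 + X : ℝ[X]) ^ a * (1 + C (1 / 2 : ℝ) * X) ^ k) m
  rw [pow_succ', mul_assoc]
  simpa using this

theorem halfWeight_succ_right (a k m : ℕ) :
    halfWeight a (k + 1) (m + 1) = halfWeight a k (m + 1) + 1 / 2 * halfWeight a k m := by
  unfold halfWeight
  have := coeff_one_add_mul (1 / 2) ((1 + X : ℝ[X]) ^ a * (1 + C (1 / 2 : ℝ) * X) ^ k) m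
  rw [← this]
  congr 1
  ring

/-- Compare coefficients in the derivative of the generating polynomial. Probabilistically, the
expected numbers of chosen elements of the two weights add up to `m + 1`. -/
theorem succ_mul_halfWeight (a k m : ℕ) :
    (m + 1) * halfWeight (a + 1) (k + 1) (m + 1) =
      (a + 1) * halfWeight a (k + 1) m + (k + 1) / 2 * halfWeight (a + 1) k m := by
  unfold halfWeight
  have h := coeff_derivative ((1 + X : ℝ[X]) ^ (a + 1) * (1 + C (1 / 2 : ℝ) * X) ^ (k + 1)) m
  rw [mul_comm ((m : ℝ) + 1), ← h]
  have h2 : derivative ((1 + X : ℝ[X]) ^ (a + 1) * (1 + C (1 / 2 : ℝ) * X) ^ (k + 1)) =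
      C ((a : ℝ) + 1) * ((1 + X : ℝ[X]) ^ a * (1 + C (1 / 2 : ℝ) * X) ^ (k + 1)) +
      C (((k : ℝ) + 1) / 2) * ((1 + X : ℝ[X]) ^ (a + 1) * (1 + C (1 / 2 : ℝ) * X) ^ k) := by
    rw [derivative_mul, derivative_pow_succ, derivative_pow_succ]
    have : C (((k : ℝ) + 1) / 2) = C ((k : ℝ) + 1) * C (1 / 2) := by rw [← C_mul]; congr 1; ring
    rw [this]
    simp
    ring
  rw [h2, coeff_add, coeff_C_mul, coeff_C_mul]

theorem halfWeight_zero_right (a m : ℕ) : halfWeight a 0 m = a.choose m := by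
  simp [halfWeight, coeff_one_add_X_pow]

theorem halfWeight_zero (a k : ℕ) : halfWeight a k 0 = 1 := by
  simp [halfWeight, coeff_zero_eq_eval_zero]

theorem halfWeight_nonneg (a k m : ℕ) : 0 ≤ halfWeight a k m := by
  induction k generalizing m with
  | zero => rw [halfWeight_zero_right]; positivity
  | succ k ih =>
    cases m with
    | zero => rw [halfWeight_zero]; norm_num
    | succ m =>
      rw [halfWeight_succ_right]
      have := ih m
      have := ih (m + 1)
      positivity

theorem halfWeight_pos (a k m : ℕ) (h : m ≤ a + k) : 0 < halfWeight a k m := by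
  induction k generalizing m with
  | zero => rw [halfWeight_zero_right]; exact_mod_cast Nat.choose_pos h
  | succ k ih =>
    cases m with
    | zero => rw [halfWeight_zero]; norm_num
    | succ m =>
      rw [halfWeight_succ_right]
      have := ih m (by omega)
      have := halfWeight_nonneg a k (m + 1)
      positivity

end HalfWeights

/-! ### Asymptotics of `E 2^(-X)` for a hypergeometric `X` -/

section Asymptotics

open Filter Topology

/-- The expectation of `2 ^ (-X)`, where `X` is the number of elements of a uniformly random
`m`-subset of an `N`-set that fall into a given `k`-set. -/
noncomputable def halfProb (N k m : ℕ) : ℝ := halfWeight (N - k) k m / N.choose m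

/-- The probability that an element of weight `1` belongs to the random `(m + 1)`-subset, if `k` of
the `N` elements have weight `1 / 2` and the others have weight `1`. -/
noncomputable def presence (N m k : ℕ) : ℝ :=
  halfWeight (N - k - 1) k m / halfWeight (N - k) k (m + 1)

variable {N m k : ℕ}

theorem presence_nonneg : 0 ≤ presence N m k :=
  div_nonneg (halfWeight_nonneg _ _ _) (halfWeight_nonneg _ _ _)

theorem halfWeight_sub_eq (hk : k < N) :
    halfWeight (N - k) k (m + 1) =
      halfWeight (N - k - 1) k (m + 1) + halfWeight (N - k - 1) k m := by
  rw [← halfWeight_succ_left]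
  congr 1
  omega

theorem presence_le_one (hk : k < N) : presence N m k ≤ 1 := by
  refine div_le_one_of_le₀ ?_ (halfWeight_nonneg _ _ _)
  rw [halfWeight_sub_eq hk]
  linarith [halfWeight_nonneg (N - k - 1) k (m + 1)]

theorem presence_mul (hk : k < N) (hm : m < N) :
    presence N m k * halfWeight (N - k) k (m + 1) = halfWeight (N - k - 1) k m :=
  div_mul_cancel₀ _ (halfWeight_pos _ _ _ (by omega)).ne'

/-- Halving the weight of one element halves the contribution of the subsets containing it. -/
theorem halfWeight_step (hk : k < N) (hm : m < N) :
    halfWeight (N - (k + 1)) (k + 1) (m + 1) =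
      halfWeight (N - k) k (m + 1) * (1 - presence N m k / 2) := by
  rw [halfWeight_succ_right, ← Nat.sub_sub]
  linear_combination (1 / 2 : ℝ) * presence_mul hk hm - halfWeight_sub_eq (m := m) hk

/-- The inclusion probabilities in a random `(m + 1)`-subset sum to `m + 1`. If an element has
inclusion probability `r` at weight `1`, halving its weight changes this to `(r / 2) / (1 - r / 2) =
r / (2 - r)`, which accounts for the second term. -/
theorem presence_recursion (hk : k + 1 < N) (hm : m < N) :
    (N - k - 1 : ℝ) * presence N m (k + 1) +
      (k + 1) * (presence N m k / (2 - presence N m k)) = m + 1 := by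
  have h1 := succ_mul_halfWeight (N - (k + 1) - 1) k m
  have e1 : N - (k + 1) - 1 + 1 = N - (k + 1) := by omega
  have h2 := presence_mul hk hm
  have h3 := presence_mul (show k < N by omega) hm
  have h4 := halfWeight_step (show k < N by omega) hm
  have hpos := halfWeight_pos (N - k) k (m + 1) (by omega)
  have hle := presence_le_one (m := m) (show k < N by omega)
  have e2 : ((N - (k + 1) - 1 : ℕ) : ℝ) + 1 = N - k - 1 := by
    rw [Nat.cast_sub (by omega), Nat.cast_sub (by omega)]
    push_cast
    ring
  rw [e1, e2, ← h2, Nat.sub_add_eq N k 1, ← h3, ← Nat.sub_add_eq N k 1, h4] at h1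
  have h5 : (2 - presence N m k) ≠ 0 := by linarith
  have h6 := mul_right_cancel₀ (b := halfWeight (N - k) k (m + 1)) hpos.ne'
    (a := (m + 1) * (1 - presence N m k / 2))
    (c := (N - k - 1) * (presence N m (k + 1) * (1 - presence N m k / 2)) +
      (k + 1) / 2 * presence N m k) (by linarith)
  field_simp
  linarith

theorem presence_zero (hm : m < N) : presence N m 0 = ((m + 1 : ℕ) : ℝ) / N := by
  unfold presence
  rw [halfWeight_zero_right, halfWeight_zero_right, Nat.sub_zero]
  have h : N = N - 1 + 1 := by omega
  have h1 := Nat.add_one_mul_choose_eq (N - 1) m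
  rw [← h] at h1
  have h2 : (N : ℝ) * (N - 1).choose m = N.choose (m + 1) * ((m + 1 : ℕ) : ℝ) := by
    exact_mod_cast h1
  have h3 : (0 : ℝ) < N := by exact_mod_cast (by omega : 0 < N)
  have h4 : (0 : ℝ) < N.choose (m + 1) := by exact_mod_cast Nat.choose_pos hm
  rw [div_eq_div_iff h4.ne' h3.ne']
  linarith

theorem presence_sub (hk : k + 1 < N) (hm : m < N) :
    presence N m (k + 1) - ((m + 1 : ℕ) : ℝ) / N = (k + 1 : ℝ) / (N - k - 1) *
      (((m + 1 : ℕ) : ℝ) / N - presence N m k / (2 - presence N m k)) := by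
  have h := presence_recursion hk hm
  have h3 : (0 : ℝ) < N := by exact_mod_cast (by omega : 0 < N)
  have h4 : (0 : ℝ) < N - k - 1 := by
    have : ((k + 1 : ℕ) : ℝ) < N := by exact_mod_cast hk
    push_cast at this
    linarith
  have h5 : presence N m (k + 1) = (((m + 1 : ℕ) : ℝ) -
      (k + 1) * (presence N m k / (2 - presence N m k))) / (N - k - 1) := by
    rw [eq_div_iff h4.ne']
    push_cast
    linarith
  rw [h5]
  generalize presence N m k / (2 - presence N m k) = r
  field_simp
  ring

theorem div_two_sub_mem {t : ℝ} (h0 : 0 ≤ t) (h1 : t ≤ 1) : 0 ≤ t / (2 - t) ∧ t / (2 - t) ≤ 1 :=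
  ⟨div_nonneg h0 (by linarith), div_le_one_of_le₀ (by linarith) (by linarith)⟩

theorem abs_div_two_sub_sub_le {s t : ℝ} (hs1 : s ≤ 1) (ht1 : t ≤ 1) :
    |s / (2 - s) - t / (2 - t)| ≤ 2 * |s - t| := by
  have hs : 0 < 2 - s := by linarith
  have ht : 0 < 2 - t := by linarith
  have : s / (2 - s) - t / (2 - t) = 2 * (s - t) / ((2 - s) * (2 - t)) := by
    field_simp
    ring
  rw [this, abs_div, abs_mul, abs_two, abs_of_pos (mul_pos hs ht)]
  refine div_le_self (by positivity) ?_
  nlinarith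

theorem succ_div_mem (hm : m < N) :
    0 ≤ ((m + 1 : ℕ) : ℝ) / N ∧ ((m + 1 : ℕ) : ℝ) / N ≤ 1 := by
  refine ⟨by positivity, div_le_one_of_le₀ ?_ (by positivity)⟩
  exact_mod_cast hm

/-- In `presence_sub` the bracket is a difference of two numbers in `[0, 1]`. -/
theorem abs_presence_sub_le (hk : k < N) (hm : m < N) :
    |presence N m k - ((m + 1 : ℕ) : ℝ) / N| ≤ (k : ℝ) / (N - k) := by
  cases k with
  | zero => rw [presence_zero hm]; simp
  | succ k =>
    have h4 : (0 : ℝ) < N - k - 1 := by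
      have : ((k + 1 : ℕ) : ℝ) < N := by exact_mod_cast hk
      push_cast at this
      linarith
    have h4' : ((N : ℝ) - (k + 1 : ℕ)) = N - k - 1 := by push_cast; ring
    have h0 : 0 ≤ ((k : ℝ) + 1) / (N - k - 1) := by positivity
    rw [presence_sub hk hm, abs_mul, abs_of_nonneg h0, h4', Nat.cast_succ k]
    refine mul_le_of_le_one_right h0 ?_
    have h1 := div_two_sub_mem presence_nonneg (presence_le_one (m := m) (show k < N by omega))
    have h2 := succ_div_mem hm
    rw [abs_le]
    constructor <;> linarith [h1.1, h1.2, h2.1, h2.2]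

/-- Bootstrapping: the crude estimate `abs_presence_sub_le` is inserted into the right-hand side of
`presence_sub`, whose dependence on the previous presence is Lipschitz. -/
theorem abs_presence_sub_sub_le (hk : 2 * k ≤ N) (hm : m < N) :
    |presence N m k - ((m + 1 : ℕ) : ℝ) / N - (k : ℝ) / N * (((m + 1 : ℕ) : ℝ) / N -
      ((m + 1 : ℕ) : ℝ) / N / (2 - ((m + 1 : ℕ) : ℝ) / N))| ≤ 12 * ((k : ℝ) / N) ^ 2 := by
  have h3 : (0 : ℝ) < N := by exact_mod_cast (by omega : 0 < N)
  cases k with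
  | zero => rw [presence_zero hm]; simp
  | succ k =>
    have hk' : k + 1 < N := by omega
    have hkN : 2 * ((k : ℝ) + 1) ≤ N := by exact_mod_cast hk
    have hk0 : (0 : ℝ) ≤ k := by positivity
    have h4 : (0 : ℝ) < N - k - 1 := by linarith
    have hp := succ_div_mem hm
    have hr1 := presence_le_one (m := m) (show k < N by omega)
    have h1 := div_two_sub_mem hp.1 hp.2
    have h2 := abs_div_two_sub_sub_le hp.2 hr1
    have h5 := abs_presence_sub_le (show k < N by omega) hm
    rw [presence_sub hk' hm, Nat.cast_succ k]
    set p := ((m + 1 : ℕ) : ℝ) / N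
    set r := presence N m k
    have e1 : ((k : ℝ) + 1) / (N - k - 1) * (p - r / (2 - r)) - (k + 1) / N * (p - p / (2 - p)) =
      (k + 1) / (N - k - 1) * (p / (2 - p) - r / (2 - r)) +
        ((k + 1) / (N - k - 1) - (k + 1) / N) * (p - p / (2 - p)) := by ring
    have a1 : ((k : ℝ) + 1) / (N - k - 1) ≤ 2 * ((k + 1) / N) := by
      rw [← mul_div_assoc, div_le_div_iff₀ h4 h3]
      nlinarith
    have a0 : (k : ℝ) / (N - k) ≤ 2 * ((k + 1) / N) := by
      rw [← mul_div_assoc, div_le_div_iff₀ (by linarith) h3]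
      nlinarith
    have a2 : ((k : ℝ) + 1) / (N - k - 1) - (k + 1) / N ≤ 2 * ((k + 1) / N) ^ 2 := by
      have : ((k : ℝ) + 1) / (N - k - 1) - (k + 1) / N =
          (k + 1) / (N - k - 1) * ((k + 1) / N) := by field_simp; ring
      rw [this]
      have : 0 ≤ ((k : ℝ) + 1) / N := by positivity
      nlinarith
    have a3 : 0 ≤ ((k : ℝ) + 1) / (N - k - 1) - (k + 1) / N := by
      rw [sub_nonneg]
      exact div_le_div_of_nonneg_left (by linarith) h4 (by linarith)
    rw [e1]
    refine (abs_add_le _ _).trans ?_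
    rw [abs_mul, abs_mul, abs_of_nonneg a3, abs_of_nonneg (by positivity : 0 ≤ ((k : ℝ) + 1) / (N - k - 1))]
    have b1 : |p - p / (2 - p)| ≤ 1 := by
      rw [abs_le]
      constructor <;> linarith [h1.1, h1.2, hp.1, hp.2]
    have b2 : |p / (2 - p) - r / (2 - r)| ≤ 4 * ((k + 1) / N) := by
      rw [abs_sub_comm r p] at h5
      linarith
    have hx : 0 ≤ ((k : ℝ) + 1) / N := by positivity
    set x := ((k : ℝ) + 1) / N
    have c1 : ((k : ℝ) + 1) / (N - k - 1) * |p / (2 - p) - r / (2 - r)| ≤ 2 * x * (4 * x) :=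
      mul_le_mul a1 b2 (abs_nonneg _) (by positivity)
    have c2 := mul_le_mul a2 b1 (abs_nonneg _) (by positivity)
    nlinarith

theorem halfProb_eq_prod (hk : k ≤ N) (hm : m < N) :
    halfProb N k (m + 1) = ∏ i ∈ Finset.range k, (1 - presence N m i / 2) := by
  have h4 : (0 : ℝ) < N.choose (m + 1) := by exact_mod_cast Nat.choose_pos hm
  induction k with
  | zero => rw [halfProb, halfWeight_zero_right, Nat.sub_zero, div_self h4.ne']; simp
  | succ k ih =>
    rw [Finset.prod_range_succ, ← ih (by omega), halfProb, halfProb, halfWeight_step hk hm]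
    ring

theorem halfProb_pos (hk : k ≤ N) (hm : m ≤ N) : 0 < halfProb N k m :=
  div_pos (halfWeight_pos _ _ _ (by omega)) (by exact_mod_cast Nat.choose_pos hm)

theorem abs_log_one_sub_add_le {u : ℝ} (hu : |u| ≤ 1 / 2) : |Real.log (1 - u) + u| ≤ 2 * u ^ 2 := by
  have h := Real.abs_log_sub_add_sum_range_le (x := u) (by linarith) 1
  simp only [Finset.sum_range_one, zero_add, pow_one, Nat.cast_zero, div_one] at h
  rw [add_comm]
  refine h.trans ?_
  rw [div_le_iff₀ (by linarith)]
  have : |u| ^ (1 + 1) = u ^ 2 := by simp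
  rw [this]
  nlinarith [sq_nonneg u]

/-- By `halfProb_eq_prod` the logarithm is a sum over the successive halvings. The linear drift of
`presence` in `i`, summed over `i < k`, produces the quadratic term `k * (k - 1) / 2`. -/
theorem abs_log_halfProb_sub_le (hk : 4 * k ≤ N) (hm : m < N) (p : ℝ)
    (hp : p = ((m + 1 : ℕ) : ℝ) / N) :
    |Real.log (halfProb N k (m + 1)) - k * Real.log (1 - p / 2) +
      p * (1 - p) / (2 - p) ^ 2 * (k * (k - 1) / (2 * N))| ≤ 20 * ((k : ℝ) * ((k : ℝ) / N) ^ 2) := by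
  have h3 : (0 : ℝ) < N := by exact_mod_cast (by omega : 0 < N)
  have hp01 := succ_div_mem hm
  rw [← hp] at hp01
  have hkN : 4 * (k : ℝ) ≤ N := by exact_mod_cast hk
  have hsum : ∑ i ∈ Finset.range k, (i : ℝ) = k * (k - 1) / 2 := by
    clear hk hkN
    induction k with
    | zero => simp
    | succ k ih => rw [Finset.sum_range_succ, ih]; push_cast; ring
  have hlog : Real.log (halfProb N k (m + 1)) =
      ∑ i ∈ Finset.range k, Real.log (1 - presence N m i / 2) := by
    rw [halfProb_eq_prod (by omega) hm, Real.log_prod]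
    intro i hi
    have := presence_le_one (m := m) (show i < N by have := Finset.mem_range.1 hi; omega)
    linarith
  have e : Real.log (halfProb N k (m + 1)) - k * Real.log (1 - p / 2) +
      p * (1 - p) / (2 - p) ^ 2 * (k * (k - 1) / (2 * N)) = ∑ i ∈ Finset.range k,
      (Real.log (1 - presence N m i / 2) - Real.log (1 - p / 2) +
        p * (1 - p) / (2 - p) ^ 2 / N * i) := by
    rw [Finset.sum_add_distrib, Finset.sum_sub_distrib, ← hlog, ← Finset.mul_sum, hsum]
    simp only [Finset.sum_const, Finset.card_range, nsmul_eq_mul]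
    field_simp
  rw [e]
  refine (Finset.abs_sum_le_sum_abs _ _).trans ?_
  have : 20 * ((k : ℝ) * (k / N) ^ 2) = ∑ i ∈ Finset.range k, 20 * ((k : ℝ) / N) ^ 2 := by
    simp only [Finset.sum_const, Finset.card_range, nsmul_eq_mul]
    ring
  rw [this]
  refine Finset.sum_le_sum fun i hi => ?_
  have hik := Finset.mem_range.1 hi
  have hikR : (i : ℝ) ≤ k := by exact_mod_cast hik.le
  have h1 := abs_presence_sub_le (show i < N by omega) hm
  have h2 := abs_presence_sub_sub_le (k := i) (by omega) hm
  have hle := presence_le_one (m := m) (show i < N by omega)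
  rw [← hp] at h1 h2
  set r := presence N m i
  -- Chosen so that `1 - r / 2 = (1 - p / 2) * (1 - u)`.
  set u := (r - p) / (2 - p) with hu
  have h2p : 0 < 2 - p := by linarith
  have hi0 : (0 : ℝ) ≤ i := by positivity
  have hiN : (i : ℝ) / N ≤ k / N := by gcongr
  have hkN' : (k : ℝ) / N ≤ 1 / 4 := by rw [div_le_div_iff₀ h3 (by norm_num)]; linarith
  have hi0' : 0 ≤ (i : ℝ) / N := by positivity
  have huu : |u| ≤ 2 * (i / N) := by
    rw [hu, abs_div, abs_of_pos h2p]
    refine (div_le_self (abs_nonneg _) (by linarith)).trans (h1.trans ?_)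
    rw [← mul_div_assoc, div_le_div_iff₀ (by linarith) h3]
    nlinarith
  have hl : Real.log (1 - r / 2) - Real.log (1 - p / 2) = Real.log (1 - u) := by
    rw [← Real.log_div (by linarith) (by linarith)]
    congr 1
    rw [hu]
    field_simp
    ring
  have h5 := abs_log_one_sub_add_le (u := u) (by linarith)
  have h6 : |u - p * (1 - p) / (2 - p) ^ 2 / N * i| ≤ 12 * ((i : ℝ) / N) ^ 2 := by
    have : u - p * (1 - p) / (2 - p) ^ 2 / N * i =
        (r - p - i / N * (p - p / (2 - p))) / (2 - p) := by
      rw [hu]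
      field_simp
      ring
    rw [this, abs_div, abs_of_pos h2p]
    exact (div_le_self (abs_nonneg _) (by linarith)).trans h2
  rw [hl]
  have h7 : u ^ 2 ≤ (2 * (i / N)) ^ 2 := by
    rw [← sq_abs]
    gcongr
  have h8 : ((i : ℝ) / N) ^ 2 ≤ (k / N) ^ 2 := by gcongr
  calc |Real.log (1 - u) + p * (1 - p) / (2 - p) ^ 2 / N * i|
      = |(Real.log (1 - u) + u) - (u - p * (1 - p) / (2 - p) ^ 2 / N * i)| := by congr 1; ring
    _ ≤ _ := abs_sub _ _
    _ ≤ 20 * ((k : ℝ) / N) ^ 2 := by nlinarith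

theorem tendsto_choose_two_div :
    Tendsto (fun n : ℕ => (n.choose 2 : ℝ) / (n : ℝ) ^ 2) atTop (𝓝 (1 / 2)) := by
  have h : Tendsto (fun n : ℕ => (1 / 2 : ℝ) * (1 - (n : ℝ)⁻¹)) atTop (𝓝 (1 / 2 * (1 - 0))) :=
    (tendsto_const_nhds.sub tendsto_inv_atTop_nhds_zero_nat).const_mul _
  rw [sub_zero, mul_one] at h
  refine h.congr' ?_
  filter_upwards [eventually_gt_atTop 0] with n hn
  have : (0 : ℝ) < n := by exact_mod_cast hn
  rw [Nat.cast_choose_two]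
  field_simp

/-- For `k ~ c n` and `N ~ n² / 2`, the correction `k² / (2N)` tends to `c²`, while the error `k³ /
N²` vanishes. The correction is a constant factor quadratic in `c`, hence it does not cancel between
the joint probability and the product of the marginals. -/
theorem tendsto_halfProb_div_pow {p c : ℝ} (hp0 : 0 < p) (hp1 : p ≤ 1) {m : ℕ → ℕ}
    (hm : ∀ n, m n ≤ n.choose 2)
    (h : Tendsto (fun n : ℕ => (m n : ℝ) / (n.choose 2 : ℝ)) atTop (𝓝 p))
    {k : ℕ → ℕ} (hk : Tendsto (fun n : ℕ => (k n : ℝ) / n) atTop (𝓝 c)) :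
    Tendsto (fun n : ℕ => halfProb (n.choose 2) (k n) (m n) /
      (1 - (m n : ℝ) / (n.choose 2 : ℝ) / 2) ^ k n) atTop
      (𝓝 (Real.exp (-(p * (1 - p) / (2 - p) ^ 2 * c ^ 2)))) := by
  have hinv : Tendsto (fun n : ℕ => (n : ℝ)⁻¹) atTop (𝓝 0) := tendsto_inv_atTop_nhds_zero_nat
  have hN := tendsto_choose_two_div
  have hkN : Tendsto (fun n : ℕ => (k n : ℝ) / (n.choose 2 : ℝ)) atTop (𝓝 0) := by
    have := (hk.mul hinv).div hN (by norm_num)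
    rw [mul_zero, zero_div] at this
    refine this.congr' ?_
    filter_upwards [eventually_ge_atTop 2] with n hn
    have h1 : (0 : ℝ) < n := by exact_mod_cast (by omega : 0 < n)
    have h2 : (0 : ℝ) < n.choose 2 := by exact_mod_cast Nat.choose_pos hn
    simp only [Pi.div_apply]
    field_simp
  have hmain : Tendsto (fun n : ℕ => (k n : ℝ) * (k n - 1) / (2 * (n.choose 2 : ℝ))) atTop
      (𝓝 (c ^ 2)) := by
    have := (hk.mul (hk.sub hinv)).div (hN.const_mul 2) (by norm_num)
    have e : c * (c - 0) / (2 * (1 / 2)) = c ^ 2 := by ring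
    rw [e] at this
    refine this.congr' ?_
    filter_upwards [eventually_ge_atTop 2] with n hn
    have h1 : (0 : ℝ) < n := by exact_mod_cast (by omega : 0 < n)
    have h2 : (0 : ℝ) < n.choose 2 := by exact_mod_cast Nat.choose_pos hn
    simp only [Pi.div_apply]
    field_simp
  have herr : Tendsto (fun n : ℕ => 20 * ((k n : ℝ) * (k n / (n.choose 2 : ℝ)) ^ 2)) atTop
      (𝓝 0) := by
    have := ((hk.mul (hk.div hN (by norm_num))).mul hkN).const_mul 20
    rw [mul_zero, mul_zero] at this
    refine this.congr' ?_
    filter_upwards [eventually_ge_atTop 2] with n hn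
    have h1 : (0 : ℝ) < n := by exact_mod_cast (by omega : 0 < n)
    have h2 : (0 : ℝ) < n.choose 2 := by exact_mod_cast Nat.choose_pos hn
    simp only [Pi.div_apply]
    field_simp
  have hcoef : Tendsto (fun n : ℕ => (m n : ℝ) / (n.choose 2 : ℝ) *
      (1 - (m n : ℝ) / (n.choose 2 : ℝ)) / (2 - (m n : ℝ) / (n.choose 2 : ℝ)) ^ 2) atTop
      (𝓝 (p * (1 - p) / (2 - p) ^ 2)) := by
    refine (h.mul (h.const_sub 1)).div ((h.const_sub 2).pow 2) ?_
    have : 0 < 2 - p := by linarith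
    positivity
  have hlim := hcoef.mul hmain
  set E : ℕ → ℝ := fun n => Real.log (halfProb (n.choose 2) (k n) (m n)) -
    k n * Real.log (1 - (m n : ℝ) / (n.choose 2 : ℝ) / 2) with hE
  have hev : ∀ᶠ n : ℕ in atTop, 0 < n.choose 2 ∧ 4 * k n ≤ n.choose 2 ∧ 0 < m n := by
    filter_upwards [eventually_ge_atTop 2, hkN.eventually_le_const (show (0 : ℝ) < 1 / 4 by norm_num),
      h.eventually_const_lt hp0] with n hn h1 h2
    have h3 : 0 < n.choose 2 := Nat.choose_pos hn
    have h4 : (0 : ℝ) < n.choose 2 := by exact_mod_cast h3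
    refine ⟨h3, ?_, ?_⟩
    · rw [div_le_div_iff₀ h4 (by norm_num)] at h1
      have : 4 * (k n : ℝ) ≤ n.choose 2 := by linarith
      exact_mod_cast this
    · by_contra h5
      have : m n = 0 := by omega
      simp [this] at h2
  have hEE : Tendsto E atTop (𝓝 (-(p * (1 - p) / (2 - p) ^ 2 * c ^ 2))) := by
    have hdiff : Tendsto (fun n => E n + (m n : ℝ) / (n.choose 2 : ℝ) *
      (1 - (m n : ℝ) / (n.choose 2 : ℝ)) / (2 - (m n : ℝ) / (n.choose 2 : ℝ)) ^ 2 *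
      ((k n : ℝ) * (k n - 1) / (2 * (n.choose 2 : ℝ)))) atTop (𝓝 0) := by
      refine squeeze_zero_norm' ?_ herr
      filter_upwards [hev] with n ⟨h1, h2, h3⟩
      -- The expansion is stated for `m + 1` edges; positivity of the limiting density makes `m n`
      -- eventually nonzero.
      obtain ⟨m', hm'⟩ : ∃ m', m n = m' + 1 := ⟨m n - 1, by omega⟩
      have := abs_log_halfProb_sub_le h2 (m := m') (by have := hm n; omega) _ rfl
      rw [Real.norm_eq_abs]
      simp only [hE, hm']
      exact this
    have := hdiff.sub hlim
    rw [zero_sub] at this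
    refine this.congr fun n => ?_
    ring
  have := (Real.continuous_exp.tendsto _).comp hEE
  refine this.congr' ?_
  filter_upwards [hev] with n ⟨h1, h2, h3⟩
  have h4 : (0 : ℝ) < n.choose 2 := by exact_mod_cast h1
  have h5 : (m n : ℝ) / (n.choose 2 : ℝ) ≤ 1 :=
    div_le_one_of_le₀ (by exact_mod_cast hm n) h4.le
  have h6 := halfProb_pos (N := n.choose 2) (k := k n) (m := m n) (by omega) (hm n)
  simp only [Function.comp, hE]
  rw [Real.exp_sub, Real.exp_log h6, Real.exp_nat_mul, Real.exp_log (by linarith)]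

end Asymptotics

/-! ### Union bounds and a Bonferroni inequality -/

section Prob

variable {Ω : Type*} (P : PMF Ω)

theorem prob_nonneg (A : Set Ω) : 0 ≤ prob P A := ENNReal.toReal_nonneg

theorem prob_eq_toMeasure (A : Set Ω) : prob P A = ((@PMF.toMeasure Ω ⊤ P) A).toReal := by
  rw [prob, @PMF.toMeasure_apply_eq_toOuterMeasure_apply Ω ⊤ P A trivial]

theorem toOuterMeasure_le_one (A : Set Ω) : P.toOuterMeasure A ≤ 1 := by
  let _ : MeasurableSpace Ω := ⊤
  rw [← @PMF.toMeasure_apply_eq_toOuterMeasure_apply Ω ⊤ P A trivial]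
  exact MeasureTheory.prob_le_one

theorem prob_mono {A B : Set Ω} (h : A ⊆ B) : prob P A ≤ prob P B := by
  let _ : MeasurableSpace Ω := ⊤
  rw [prob_eq_toMeasure, prob_eq_toMeasure]
  exact ENNReal.toReal_mono (MeasureTheory.measure_ne_top _ _) (MeasureTheory.measure_mono h)

theorem prob_union_add_inter (A B : Set Ω) :
    prob P (A ∪ B) + prob P (A ∩ B) = prob P A + prob P B := by
  let _ : MeasurableSpace Ω := ⊤
  simp only [prob_eq_toMeasure]
  exact MeasureTheory.measureReal_union_add_inter (μ := P.toMeasure) (s := A) (t := B) trivial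

theorem prob_union_le (A B : Set Ω) : prob P (A ∪ B) ≤ prob P A + prob P B := by
  linarith [prob_union_add_inter P A B, prob_nonneg P (A ∩ B)]

theorem prob_empty : prob P ∅ = 0 := by simp [prob]

theorem prob_biUnion_le {ι : Type*} (S : Finset ι) (A : ι → Set Ω) :
    prob P (⋃ i ∈ S, A i) ≤ ∑ i ∈ S, prob P (A i) := by
  classical
  induction S using Finset.induction_on with
  | empty => simp [prob_empty]
  | insert a S ha ih =>
    rw [Finset.set_biUnion_insert, Finset.sum_insert ha]
    linarith [prob_union_le P (A a) (⋃ i ∈ S, A i)]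

/-- A crude form of the second Bonferroni inequality. -/
theorem sum_sub_le_prob_biUnion {ι : Type*} (S : Finset ι) (A : ι → Set Ω) {ε : ℝ} (hε : 0 ≤ ε)
    (h : ∀ i ∈ S, ∀ j ∈ S, i ≠ j → prob P (A i ∩ A j) ≤ ε) :
    ∑ i ∈ S, prob P (A i) - (S.card : ℝ) ^ 2 * ε ≤ prob P (⋃ i ∈ S, A i) := by
  classical
  induction S using Finset.induction_on with
  | empty => simp [prob_empty]
  | insert a S ha ih =>
    have ih' := ih fun i hi j hj => h i (Finset.mem_insert_of_mem hi) j (Finset.mem_insert_of_mem hj)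
    rw [Finset.set_biUnion_insert, Finset.sum_insert ha, Finset.card_insert_of_notMem ha]
    have h1 := prob_union_add_inter P (A a) (⋃ i ∈ S, A i)
    have h2 : prob P (A a ∩ ⋃ i ∈ S, A i) ≤ S.card * ε := by
      rw [Set.inter_iUnion₂, ← nsmul_eq_mul, ← Finset.sum_const]
      refine (prob_biUnion_le P S _).trans (Finset.sum_le_sum fun i hi => ?_)
      exact h a (Finset.mem_insert_self _ _) i (Finset.mem_insert_of_mem hi)
        (fun e => ha (e ▸ hi))
    push_cast
    have : (0 : ℝ) ≤ S.card := by positivity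
    nlinarith

end Prob

/-! ### Forbidden arcs and elementary symmetric sums -/

section Model

open Classical in
/-- The pairs of distinct vertices. -/
noncomputable def pairs (n : ℕ) : Finset (Sym2 (Fin n)) := (⊤ : SimpleGraph (Fin n)).edgeFinset

theorem mem_pairs {n : ℕ} {u v : Fin n} : s(u, v) ∈ pairs n ↔ u ≠ v := by
  simp [pairs]

theorem card_pairs (n : ℕ) : (pairs n).card = n.choose 2 := by
  rw [pairs, SimpleGraph.card_edgeFinset_top_eq_card_choose_two, Fintype.card_fin]

/-- The event that the digraph has none of the forbidden arcs. -/
def absent {n : ℕ} (forb : Fin n → Fin n → Prop) : Set (Digraph (Fin n)) :=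
  {D | ∀ u v, forb u v → ¬ D.Adj u v}

theorem absent_inter {n : ℕ} (f g : Fin n → Fin n → Prop) :
    absent f ∩ absent g = absent fun u v => f u v ∨ g u v := by
  ext D
  constructor
  · rintro ⟨h1, h2⟩ u v (h | h)
    exacts [h1 u v h, h2 u v h]
  · exact fun h => ⟨fun u v huv => h u v (Or.inl huv), fun u v huv => h u v (Or.inr huv)⟩

/-- The coin value `b` of the pair `e` does not produce a forbidden arc. -/
def CoinOk {n : ℕ} (forb : Fin n → Fin n → Prop) (e : Sym2 (Fin n)) (b : Bool) : Prop :=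
  ∀ u v, s(u, v) = e → (b = true ↔ u < v) → ¬ forb u v

open Classical in
/-- The probability that the coin of the pair `e` does not produce a forbidden arc. -/
noncomputable def coinWeight {n : ℕ} (forb : Fin n → Fin n → Prop) (e : Sym2 (Fin n)) : ℝ :=
  ∑ b : Bool, (if CoinOk forb e b then 1 / 2 else 0)

theorem orient_mem_absent_iff {n : ℕ} (forb : Fin n → Fin n → Prop) (G : SimpleGraph (Fin n))
    (ω : Sym2 (Fin n) → Bool) :
    orient G ω ∈ absent forb ↔ ∀ e ∈ G.edgeSet, CoinOk forb e (ω e) := by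
  constructor
  · rintro h e he u v rfl h1 h2
    exact h u v h2 ⟨he, h1⟩
  · rintro h u v h2 ⟨h3, h4⟩
    exact h s(u, v) h3 u v rfl h4 h2

open Classical in
-- The coins are independent and the requirement on each edge involves only its own coin, so the
-- count factorizes.
theorem card_orient_mem_absent {n : ℕ} (forb : Fin n → Fin n → Prop) (G : SimpleGraph (Fin n)) :
    ((Finset.univ.filter fun ω => orient G ω ∈ absent forb).card : ℝ) /
      Fintype.card (Sym2 (Fin n) → Bool) = ∏ e ∈ G.edgeFinset, coinWeight forb e := by
  have h1 : ((Finset.univ.filter fun ω => orient G ω ∈ absent forb).card : ℝ) =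
      ∑ ω : Sym2 (Fin n) → Bool, ∏ e : Sym2 (Fin n),
        (if e ∈ G.edgeFinset then (if CoinOk forb e (ω e) then (1 : ℝ) else 0) else 1) := by
    rw [Finset.card_filter, Nat.cast_sum]
    refine Finset.sum_congr rfl fun ω _ => ?_
    rw [Finset.prod_ite_mem, Finset.univ_inter]
    simp only [orient_mem_absent_iff]
    rw [Finset.prod_ite_zero]
    simp
  rw [h1, ← Fintype.prod_sum (fun e b =>
    (if e ∈ G.edgeFinset then (if CoinOk forb e b then (1 : ℝ) else 0) else 1)), Fintype.card_fun,
    Nat.cast_pow, ← Finset.card_univ (α := Sym2 (Fin n)), ← Finset.prod_const, ← Finset.prod_div_distrib,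
    ← Finset.univ_inter G.edgeFinset, ← Finset.prod_ite_mem]
  simp only [Finset.univ_inter]
  refine Finset.prod_congr rfl fun e _ => ?_
  by_cases he : e ∈ G.edgeFinset
  · simp only [he, if_true, coinWeight, Finset.sum_div, Fintype.card_bool]
    refine Finset.sum_congr rfl fun b _ => ?_
    split_ifs <;> simp
  · simp [he]

open Classical in
theorem sum_graph_eq_sum_powersetCard {n : ℕ} (m : ℕ) (g : Finset (Sym2 (Fin n)) → ℝ) :
    ∑ G ∈ Finset.univ.filter (fun G : SimpleGraph (Fin n) => G.edgeSet.ncard = m),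
      g G.edgeFinset = ∑ M ∈ (pairs n).powersetCard m, g M := by
  refine Finset.sum_bij (fun G _ => G.edgeFinset) ?_ ?_ ?_ ?_
  · intro G hG
    rw [Finset.mem_powersetCard]
    refine ⟨?_, ?_⟩
    · rw [pairs]
      exact SimpleGraph.edgeFinset_mono le_top
    · rw [← (Finset.mem_filter.1 hG).2, ← SimpleGraph.coe_edgeFinset, Set.ncard_coe_finset]
  · intro G _ G' _ h
    exact SimpleGraph.edgeFinset_inj.1 h
  · intro M hM
    obtain ⟨h1, h2⟩ := Finset.mem_powersetCard.1 hM
    have h3 : (SimpleGraph.fromEdgeSet (M : Set (Sym2 (Fin n)))).edgeSet = M := by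
      rw [SimpleGraph.edgeSet_fromEdgeSet]
      ext e
      simp only [Set.mem_sdiff, and_iff_left_iff_imp]
      intro he hd
      have h4 := h1 he
      rw [pairs, SimpleGraph.mem_edgeFinset] at h4
      exact SimpleGraph.not_isDiag_of_mem_edgeSet _ h4 hd
    refine ⟨SimpleGraph.fromEdgeSet M, ?_, ?_⟩
    · simp only [Finset.mem_filter, Finset.mem_univ, true_and]
      rw [h3, Set.ncard_coe_finset, h2]
    · rw [← Finset.coe_inj, SimpleGraph.coe_edgeFinset, h3]
  · intro G _
    rfl

open Classical in
theorem card_graph {n : ℕ} (m : ℕ) :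
    (Finset.univ.filter (fun G : SimpleGraph (Fin n) => G.edgeSet.ncard = m)).card =
      (n.choose 2).choose m := by
  have := sum_graph_eq_sum_powersetCard (n := n) m fun _ => 1
  simp only [Finset.sum_const, nsmul_eq_mul, mul_one, Finset.card_powersetCard, card_pairs] at this
  exact_mod_cast this

open Classical in
theorem prob_orientedGnm (n m : ℕ) (h : m ≤ n.choose 2) (A : Set (Digraph (Fin n))) :
    prob (orientedGnm n m h) A =
      (∑ G ∈ Finset.univ.filter (fun G : SimpleGraph (Fin n) => G.edgeSet.ncard = m),
        ((Finset.univ.filter fun ω => orient G ω ∈ A).card : ℝ) /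
          Fintype.card (Sym2 (Fin n) → Bool)) / (n.choose 2).choose m := by
  rw [prob, orientedGnm, PMF.toOuterMeasure_bind_apply, tsum_fintype, ENNReal.toReal_sum]
  · rw [Finset.sum_div, Finset.sum_filter]
    refine Finset.sum_congr rfl fun G _ => ?_
    rw [PMF.toOuterMeasure_map_apply, PMF.toOuterMeasure_uniformOfFintype_apply, gnm,
      PMF.uniformOfFinset_apply, ENNReal.toReal_mul]
    by_cases hG : G.edgeSet.ncard = m
    · have : Fintype.card ↑(orient G ⁻¹' A) =
          (Finset.univ.filter fun ω => orient G ω ∈ A).card := by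
        rw [Fintype.card_subtype]
        rfl
      simp only [Finset.mem_filter, Finset.mem_univ, true_and, hG, if_true, card_graph]
      rw [this]
      simp only [ENNReal.toReal_inv, ENNReal.toReal_natCast, ENNReal.toReal_div]
      ring
    · simp [hG]
  · intro G _
    refine ENNReal.mul_ne_top (PMF.apply_ne_top _ _) ?_
    refine ne_top_of_le_ne_top ENNReal.one_ne_top ?_
    exact toOuterMeasure_le_one _ A

theorem prob_absent (n m : ℕ) (h : m ≤ n.choose 2) (forb : Fin n → Fin n → Prop) :
    prob (orientedGnm n m h) (absent forb) =
      es (pairs n) m (coinWeight forb) / (n.choose 2).choose m := by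
  classical
  rw [prob_orientedGnm, es, ← sum_graph_eq_sum_powersetCard]
  congr 1
  exact Finset.sum_congr rfl fun G _ => card_orient_mem_absent forb G

end Model

/-! ### Bounds and an exact value for the absence of forbidden arcs -/

section AbsentBounds

variable {n m : ℕ}

theorem coinOk_iff (forb : Fin n → Fin n → Prop) {u v : Fin n} (huv : u < v) (b : Bool) :
    CoinOk forb s(u, v) b ↔ ¬ (if b = true then forb u v else forb v u) := by
  constructor
  · intro h
    split_ifs with hb
    · exact h u v rfl (by simp [hb, huv])
    · exact h v u Sym2.eq_swap (by simp [hb, huv.le])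
  · rintro h x y hxy hb
    rcases Sym2.eq_iff.1 hxy with ⟨rfl, rfl⟩ | ⟨rfl, rfl⟩
    · have : b = true := hb.2 huv
      simpa [this] using h
    · have : ¬ b = true := fun h' => absurd (hb.1 h') huv.asymm
      simpa [this] using h

open Classical in
theorem coinWeight_of_lt (forb : Fin n → Fin n → Prop) {u v : Fin n} (huv : u < v) :
    coinWeight forb s(u, v) =
      (if forb u v then 0 else 1 / 2) + (if forb v u then 0 else 1 / 2) := by
  simp only [coinWeight, Fintype.sum_bool, coinOk_iff forb huv]
  simp

open Classical in
theorem coinWeight_mk (forb : Fin n → Fin n → Prop) {u v : Fin n} (huv : u ≠ v) :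
    coinWeight forb s(u, v) =
      (if forb u v then 0 else 1 / 2) + (if forb v u then 0 else 1 / 2) := by
  rcases lt_or_gt_of_ne huv with h | h
  · exact coinWeight_of_lt forb h
  · rw [Sym2.eq_swap, coinWeight_of_lt forb h, add_comm]

theorem coinWeight_mem (forb : Fin n → Fin n → Prop) (e : Sym2 (Fin n)) :
    0 ≤ coinWeight forb e ∧ coinWeight forb e ≤ 1 := by
  classical
  simp only [coinWeight, Fintype.sum_bool]
  split_ifs <;> norm_num

theorem density_mem (h : m ≤ n.choose 2) :
    0 ≤ (m : ℝ) / (n.choose 2 : ℝ) ∧ (m : ℝ) / (n.choose 2 : ℝ) ≤ 1 :=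
  ⟨by positivity, div_le_one_of_le₀ (by exact_mod_cast h) (by positivity)⟩

/-- By `es_le_choose_mul_prod` the probability is at most a product over all pairs. Only the factors
of pairs between `K` and `L` are kept, the others being at most `1`. -/
theorem prob_absent_le_pow (h : m ≤ n.choose 2) (forb : Fin n → Fin n → Prop) {c : ℝ}
    (K L : Finset (Fin n)) (hKL : Disjoint K L)
    (hw : ∀ u ∈ K, ∀ v ∈ L, coinWeight forb s(u, v) ≤ 1 - c) :
    prob (orientedGnm n m h) (absent forb) ≤
      (1 - (m : ℝ) / (n.choose 2 : ℝ) * c) ^ (K.card * L.card) := by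
  have hp := density_mem h
  have hcard := card_pairs n
  have h0 : (0 : ℝ) < (n.choose 2).choose m := by exact_mod_cast Nat.choose_pos h
  rw [prob_absent, div_le_iff₀ h0, mul_comm]
  have h1 := es_le_choose_mul_prod (pairs n) m (by rw [hcard]; exact h) (coinWeight forb)
    fun e _ => coinWeight_mem forb e
  rw [hcard] at h1
  refine h1.trans (mul_le_mul_of_nonneg_left ?_ h0.le)
  set p := (m : ℝ) / (n.choose 2 : ℝ)
  have hne : ∀ u ∈ K, ∀ v ∈ L, u ≠ v := fun u hu v hv e =>
    Finset.disjoint_left.1 hKL hu (e ▸ hv)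
  have hinj : Set.InjOn (fun x : Fin n × Fin n => s(x.1, x.2)) (K ×ˢ L : Finset (Fin n × Fin n)) := by
    rintro ⟨u, v⟩ hx ⟨u', v'⟩ hy hxy
    simp only [Finset.coe_product, Set.mem_prod, Finset.mem_coe] at hx hy
    rcases Sym2.eq_iff.1 hxy with ⟨h1, h2⟩ | ⟨h1, h2⟩
    · exact Prod.ext h1 h2
    · exact absurd h1 (hne _ hx.1 _ hy.2)
  have hE : (K ×ˢ L).image (fun x => s(x.1, x.2)) ⊆ pairs n := by
    intro e he
    obtain ⟨⟨u, v⟩, hx, rfl⟩ := Finset.mem_image.1 he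
    rw [Finset.mem_product] at hx
    exact mem_pairs.2 (hne _ hx.1 _ hx.2)
  have hf : ∀ e, 0 ≤ 1 - p * (1 - coinWeight forb e) ∧ 1 - p * (1 - coinWeight forb e) ≤ 1 := by
    intro e
    have := coinWeight_mem forb e
    constructor <;> nlinarith
  calc ∏ e ∈ pairs n, (1 - p * (1 - coinWeight forb e))
      ≤ ∏ e ∈ (K ×ˢ L).image (fun x => s(x.1, x.2)), (1 - p * (1 - coinWeight forb e)) := by
        rw [← Finset.prod_sdiff hE]
        exact mul_le_of_le_one_left (Finset.prod_nonneg fun e _ => (hf e).1)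
          (Finset.prod_le_one (fun e _ => (hf e).1) fun e _ => (hf e).2)
    _ = ∏ x ∈ K ×ˢ L, (1 - p * (1 - coinWeight forb s(x.1, x.2))) := Finset.prod_image hinj
    _ ≤ ∏ x ∈ K ×ˢ L, (1 - p * c) := by
        refine Finset.prod_le_prod (fun x _ => (hf _).1) fun x hx => ?_
        rw [Finset.mem_product] at hx
        have := hw _ hx.1 _ hx.2
        nlinarith
    _ = _ := by rw [Finset.prod_const, Finset.card_product]

theorem prob_absent_le_of_or (h : m ≤ n.choose 2) (forb : Fin n → Fin n → Prop)
    (K L : Finset (Fin n)) (hKL : Disjoint K L)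
    (hf : ∀ u ∈ K, ∀ v ∈ L, forb u v ∨ forb v u) :
    prob (orientedGnm n m h) (absent forb) ≤
      (1 - (m : ℝ) / (n.choose 2 : ℝ) / 2) ^ (K.card * L.card) := by
  classical
  rw [div_eq_mul_one_div _ (2 : ℝ)]
  refine prob_absent_le_pow h forb K L hKL fun u hu v hv => ?_
  have huv : u ≠ v := fun e => Finset.disjoint_left.1 hKL hu (e ▸ hv)
  rw [coinWeight_mk forb huv]
  rcases hf u hu v hv with h1 | h1 <;> simp only [h1, if_true] <;> split_ifs <;> norm_num

theorem prob_absent_le_of_and (h : m ≤ n.choose 2) (forb : Fin n → Fin n → Prop)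
    (K L : Finset (Fin n)) (hKL : Disjoint K L)
    (hf : ∀ u ∈ K, ∀ v ∈ L, forb u v ∧ forb v u) :
    prob (orientedGnm n m h) (absent forb) ≤
      (1 - (m : ℝ) / (n.choose 2 : ℝ)) ^ (K.card * L.card) := by
  classical
  have := prob_absent_le_pow (c := 1) h forb K L hKL fun u hu v hv => by
    have huv : u ≠ v := fun e => Finset.disjoint_left.1 hKL hu (e ▸ hv)
    rw [coinWeight_mk forb huv]
    simp [hf u hu v hv]
  rwa [mul_one] at this

/-- The number of pairs of vertices that meet a given set of `t` of the `n` vertices. -/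
def touchingPairs (n t : ℕ) : ℕ := n.choose 2 - (n - t).choose 2

/-- Pairs inside `U` are unconstrained and have weight `1`; every other pair has exactly one
forbidden direction and so weight `1/2`. -/
theorem prob_absent_eq (h : m ≤ n.choose 2) (forb : Fin n → Fin n → Prop) (U : Finset (Fin n))
    {t : ℕ} (hU : U.card = n - t) (h1 : ∀ u ∈ U, ∀ v ∈ U, ¬ forb u v)
    (h2 : ∀ u v, u ≠ v → (u ∉ U ∨ v ∉ U) → (forb u v ↔ ¬ forb v u)) :
    prob (orientedGnm n m h) (absent forb) = halfProb (n.choose 2) (touchingPairs n t) m := by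
  classical
  have hc : (U.offDiag.image (fun x => s(x.1, x.2))).card = (n - t).choose 2 := by
    rw [← hU]
    exact Sym2.card_image_offDiag U
  have hsub : U.offDiag.image (fun x => s(x.1, x.2)) ⊆ pairs n := by
    intro e he
    obtain ⟨⟨u, v⟩, hx, rfl⟩ := Finset.mem_image.1 he
    exact mem_pairs.2 (Finset.mem_offDiag.1 hx).2.2
  have hle : (n - t).choose 2 ≤ n.choose 2 := Nat.choose_le_choose 2 (Nat.sub_le n t)
  rw [prob_absent, halfProb, es_eq_halfWeight (pairs n) _ hsub, hc, card_pairs]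
  · unfold touchingPairs
    rw [Nat.sub_sub_self hle]
  · intro e he
    obtain ⟨⟨u, v⟩, hx, rfl⟩ := Finset.mem_image.1 he
    obtain ⟨hu, hv, huv⟩ := Finset.mem_offDiag.1 hx
    simp only at hu hv huv ⊢
    rw [coinWeight_mk forb huv]
    simp only [h1 u hu v hv, h1 v hv u hu, if_false]
    norm_num
  · intro e he
    obtain ⟨he1, he2⟩ := Finset.mem_sdiff.1 he
    induction e using Sym2.ind with
    | _ u v =>
      have huv : u ≠ v := mem_pairs.1 he1
      rw [coinWeight_mk forb huv]
      have h3 : u ∉ U ∨ v ∉ U := by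
        by_contra! h4
        exact he2 (Finset.mem_image.2 ⟨(u, v), Finset.mem_offDiag.2 ⟨h4.1, h4.2, huv⟩, rfl⟩)
      have h4 := h2 u v huv h3
      by_cases h5 : forb v u
      · simp [h4, h5]
      · simp [h4, h5]

end AbsentBounds

/-! ### Summing over colourings close to a constant one -/

section Colourings

theorem exists_card_le_mul_card_fiber {V C : Type*} [Fintype V] [Fintype C] [Nonempty C]
    [DecidableEq C] (φ : V → C) :
    ∃ κ, Fintype.card V ≤ Fintype.card C * (Finset.univ.filter fun v => φ v = κ).card := by
  by_contra! h
  have h1 : ∑ κ : C, (Finset.univ.filter fun v => φ v = κ).card = Fintype.card V := by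
    rw [← Finset.card_univ]
    exact (Finset.card_eq_sum_card_fiberwise fun v _ => Finset.mem_univ _).symm
  have h2 : ∑ κ : C, Fintype.card C * (Finset.univ.filter fun v => φ v = κ).card <
      ∑ κ : C, Fintype.card V := Finset.sum_lt_sum_of_nonempty Finset.univ_nonempty fun κ _ => h κ
  rw [← Finset.mul_sum, h1] at h2
  simp at h2

/-- The sum factorizes over vertices: each contributes `1` for the colour `κ` and `y` for every
other colour. -/
theorem sum_pow_card_ne {V C : Type*} [Fintype V] [DecidableEq V] [Fintype C] [DecidableEq C]
    (κ : C) (y : ℝ) :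
    ∑ φ : V → C, y ^ (Finset.univ.filter fun v => φ v ≠ κ).card =
      (1 + ((Fintype.card C : ℝ) - 1) * y) ^ Fintype.card V := by
  have h1 : ∀ φ : V → C, y ^ (Finset.univ.filter fun v => φ v ≠ κ).card =
      ∏ v, (if φ v ≠ κ then y else 1) := fun φ => by
    rw [Finset.prod_ite, Finset.prod_const, Finset.prod_const_one, mul_one]
  simp_rw [h1]
  rw [← Fintype.prod_sum (fun (_ : V) c => if c ≠ κ then y else 1), Finset.prod_const,
    Finset.card_univ]
  congr 1
  rw [← Finset.add_sum_erase _ _ (Finset.mem_univ κ)]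
  simp only [ne_eq, not_true_eq_false, if_false]
  rw [Finset.sum_congr rfl (g := fun _ => y) fun c hc => by simp [Finset.ne_of_mem_erase hc],
    Finset.sum_const, Finset.card_erase_of_mem (Finset.mem_univ κ), nsmul_eq_mul, Finset.card_univ,
    Nat.cast_sub (Fintype.card_pos_iff.2 ⟨κ⟩), Nat.cast_one]

/-- The total weight of colourings that are small perturbations of a constant colouring. -/
theorem sum_colouring_le {V C : Type*} [Fintype V] [DecidableEq V] [Fintype C] [DecidableEq C]
    (S : Finset (V → C)) (w : (V → C) → ℝ) {B y : ℝ} (hB : 0 ≤ B) (hy : 0 ≤ y)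
    (h : ∀ φ ∈ S, ∃ κ, (∃ v, φ v ≠ κ) ∧
      w φ ≤ B * y ^ (Finset.univ.filter fun v => φ v ≠ κ).card) :
    ∑ φ ∈ S, w φ ≤ Fintype.card C *
      (B * ((1 + ((Fintype.card C : ℝ) - 1) * y) ^ Fintype.card V - 1)) := by
  -- The majorant omits the constant colouring; this is the `- 1` in the bound, without which the
  -- sum would not be small.
  set g : C → (V → C) → ℝ := fun κ φ => if φ = fun _ => κ then 0 else
    B * y ^ (Finset.univ.filter fun v => φ v ≠ κ).card with hg
  have hg0 : ∀ κ φ, 0 ≤ g κ φ := fun κ φ => by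
    simp only [hg]
    split_ifs
    exacts [le_rfl, by positivity]
  have h1 : ∀ κ, ∑ φ, g κ φ =
      B * ((1 + ((Fintype.card C : ℝ) - 1) * y) ^ Fintype.card V - 1) := fun κ => by
    rw [← sum_pow_card_ne κ y, mul_sub, Finset.mul_sum,
      ← Finset.add_sum_erase _ (fun φ => g κ φ) (Finset.mem_univ fun _ => κ),
      ← Finset.add_sum_erase _ (fun φ => B * y ^ _) (Finset.mem_univ fun _ => κ)]
    simp only [hg, if_true, ne_eq, not_true_eq_false, Finset.filter_false, Finset.card_empty,
      pow_zero, mul_one, zero_add, add_sub_cancel_left]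
    exact Finset.sum_congr rfl fun φ hφ => by rw [if_neg (Finset.ne_of_mem_erase hφ)]
  calc ∑ φ ∈ S, w φ ≤ ∑ φ ∈ S, ∑ κ, g κ φ := by
        refine Finset.sum_le_sum fun φ hφ => ?_
        obtain ⟨κ, ⟨v, hv⟩, h2⟩ := h φ hφ
        have h3 : φ ≠ fun _ => κ := fun e => hv (congrFun e v)
        refine le_trans ?_ (Finset.single_le_sum (fun κ _ => hg0 κ φ) (Finset.mem_univ κ))
        simp only [hg, if_neg h3]
        exact h2
    _ ≤ ∑ φ, ∑ κ, g κ φ := Finset.sum_le_sum_of_subset_of_nonneg (Finset.subset_univ _)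
        fun φ _ _ => Finset.sum_nonneg fun κ _ => hg0 κ φ
    _ = ∑ κ : C, ∑ φ, g κ φ := Finset.sum_comm
    _ = _ := by simp_rw [h1]; rw [Finset.sum_const, nsmul_eq_mul, Finset.card_univ]

/-- Here `k` is the size of a largest colour class and `j` the number of other vertices, so `k * j`
pairs cross. They pay for the main order `d * n` and leave `n / 8` for each exceptional vertex. For
`6 * j ≤ n` this is `2/3 + 1/8 ≤ 5/6`; otherwise `j > 16 ≥ 8 * d`, by `96 ≤ n`, and `1/8 + 1/8 =
1/4` suffices. -/
theorem mul_add_mul_le_mul {n d j k : ℕ} (hn : 96 ≤ n) (hjk : k + j = n) (hk : n ≤ 4 * k)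
    (hd : d ≤ 2) (hdj : d < j) : d * n + j * (n / 8) ≤ k * j := by
  have h8 : 8 * (n / 8) ≤ n := Nat.mul_div_le n 8
  have h1 : 8 * (j * (n / 8)) ≤ j * n := by nlinarith
  have h2 : 3 * d ≤ 2 * j := by omega
  by_cases h6 : 6 * j ≤ n
  · have h3 : 3 * (d * n) ≤ 2 * (j * n) := by nlinarith
    have h4 : 5 * (j * n) ≤ 6 * (k * j) := by nlinarith
    omega
  · have h3 : j * n ≤ 4 * (k * j) := by nlinarith
    have h4 : 8 * (d * n) ≤ j * n := by nlinarith
    omega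

end Colourings

/-! ### Monotone colourings with prescribed marks -/

section Chains

variable {n m c : ℕ}

/-- No arc leads from a vertex to a vertex of larger colour. -/
def chain (φ : Fin n → Fin c) : Set (Digraph (Fin n)) := absent fun u v => φ u < φ v

theorem le_of_mem_chain {φ : Fin n → Fin c} {D : Digraph (Fin n)} (hD : D ∈ chain φ) {u v : Fin n}
    (h : Relation.ReflTransGen D.Adj u v) : φ v ≤ φ u := by
  induction h with
  | refl => exact le_rfl
  | tail _ h2 ih => exact (not_lt.1 fun h3 => hD _ _ h3 h2).trans ih

/-- The colourings that give the `i`-th marked vertex the colour `i`. -/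
def markedColourings (μ : Fin c → Fin n) : Finset (Fin n → Fin c) :=
  Finset.univ.filter fun φ => ∀ i, φ (μ i) = i

/-- There is a colouring with the prescribed colours on the marked vertices
that does not increase along arcs. -/
def separated (μ : Fin c → Fin n) : Set (Digraph (Fin n)) :=
  ⋃ φ ∈ markedColourings μ, chain φ

/-- The colouring that is constant off the marked vertices. -/
noncomputable def monoColouring (μ : Fin c → Fin n) (κ : Fin c) : Fin n → Fin c :=
  Function.extend μ id fun _ => κ

variable {μ : Fin c → Fin n}

theorem monoColouring_mark (hμ : Function.Injective μ) (κ i : Fin c) :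
    monoColouring μ κ (μ i) = i := hμ.extend_apply _ _ _

theorem monoColouring_of_notMem {κ : Fin c} {v : Fin n} (hv : ∀ i, μ i ≠ v) :
    monoColouring μ κ v = κ := Function.extend_apply' _ _ _ fun ⟨i, hi⟩ => hv i hi

theorem monoColouring_ne_iff (hμ : Function.Injective μ) {κ : Fin c} {v : Fin n} :
    monoColouring μ κ v ≠ κ ↔ ∃ i, i ≠ κ ∧ μ i = v := by
  constructor
  · intro h
    by_contra! h'
    by_cases h2 : ∃ i, μ i = v
    · obtain ⟨i, rfl⟩ := h2
      rw [monoColouring_mark hμ] at h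
      exact h' i h rfl
    · exact h (monoColouring_of_notMem (by simpa using h2))
  · rintro ⟨i, hi, rfl⟩
    rwa [monoColouring_mark hμ]

/-- The vertices not coloured `κ` are the other `c - 1` marks, with pairwise distinct colours. Hence
each pair meeting them has exactly one forbidden direction. -/
theorem prob_chain_monoColouring (hμ : Function.Injective μ) (h : m ≤ n.choose 2) (κ : Fin c) :
    prob (orientedGnm n m h) (chain (monoColouring μ κ)) =
      halfProb (n.choose 2) (touchingPairs n (c - 1)) m := by
  classical
  set U := Finset.univ.filter fun v => monoColouring μ κ v = κ with hU
  have hUc : Uᶜ = (Finset.univ.erase κ).image μ := by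
    ext v
    rw [Finset.mem_compl, hU, Finset.mem_filter, Finset.mem_image]
    simp only [Finset.mem_univ, true_and, Finset.mem_erase, and_true]
    exact monoColouring_ne_iff hμ
  refine prob_absent_eq h _ U ?_ ?_ ?_
  · have h1 : Uᶜ.card = c - 1 := by
      rw [hUc, Finset.card_image_of_injective _ hμ, Finset.card_erase_of_mem (Finset.mem_univ _),
        Finset.card_univ, Fintype.card_fin]
    have h2 := Finset.card_add_card_compl U
    rw [Fintype.card_fin] at h2
    omega
  · intro u hu v hv
    rw [hU, Finset.mem_filter] at hu hv
    rw [hu.2, hv.2]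
    exact lt_irrefl _
  · intro u v huv huv'
    have hne : monoColouring μ κ u ≠ monoColouring μ κ v := by
      have hmem : ∀ w, w ∉ U → ∃ i, i ≠ κ ∧ μ i = w := fun w hw =>
        (monoColouring_ne_iff hμ).1 (by simpa [hU] using hw)
      intro heq
      by_cases hu : monoColouring μ κ u = κ
      · have hv : monoColouring μ κ v = κ := heq ▸ hu
        rcases huv' with h1 | h1
        · exact h1 (by simpa [hU] using hu)
        · exact h1 (by simpa [hU] using hv)
      · obtain ⟨i, -, rfl⟩ := (monoColouring_ne_iff hμ).1 hu
        rw [heq] at hu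
        obtain ⟨j, -, rfl⟩ := (monoColouring_ne_iff hμ).1 hu
        rw [monoColouring_mark hμ, monoColouring_mark hμ] at heq
        exact huv (congrArg μ heq)
    constructor
    · exact fun h1 => h1.asymm
    · exact fun h1 => lt_of_le_of_ne (not_lt.1 h1) hne

/-- A mark's colour differs from at least one of `κ`, `κ'`, so every pair of a mark and an unmarked
vertex loses a direction. All `c` marks now pay, instead of `c - 1`, and the overlap of two main
events is negligible. -/
theorem prob_inter_chain_le (hμ : Function.Injective μ) (h : m ≤ n.choose 2) {κ κ' : Fin c}
    (hκ : κ ≠ κ') :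
    prob (orientedGnm n m h) (chain (monoColouring μ κ) ∩ chain (monoColouring μ κ')) ≤
      (1 - (m : ℝ) / (n.choose 2 : ℝ) / 2) ^ (c * (n - c)) := by
  classical
  have hc : (Finset.univ.image μ).card = c := by
    rw [Finset.card_image_of_injective _ hμ, Finset.card_univ, Fintype.card_fin]
  have hc' : (Finset.univ.image μ)ᶜ.card = n - c := by
    rw [Finset.card_compl, hc, Fintype.card_fin]
  rw [chain, chain, absent_inter]
  have := prob_absent_le_of_or h
    (fun u v => monoColouring μ κ u < monoColouring μ κ v ∨
      monoColouring μ κ' u < monoColouring μ κ' v) (Finset.univ.image μ) (Finset.univ.image μ)ᶜ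
    disjoint_compl_right ?_
  · rwa [hc, hc'] at this
  · intro u hu v hv
    obtain ⟨i, -, rfl⟩ := Finset.mem_image.1 hu
    have hv' : ∀ j, μ j ≠ v := by simpa using hv
    simp only [monoColouring_mark hμ, monoColouring_of_notMem hv']
    by_cases hi : i = κ
    · subst hi
      rcases lt_or_gt_of_ne hκ with h1 | h1 <;> simp [h1]
    · rcases lt_or_gt_of_ne hi with h1 | h1 <;> simp [h1]

theorem monoColouring_mem (hμ : Function.Injective μ) (κ : Fin c) :
    monoColouring μ κ ∈ markedColourings μ := by
  simpa [markedColourings] using monoColouring_mark hμ κ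

theorem le_prob_separated (hμ : Function.Injective μ) (h : m ≤ n.choose 2) :
    c * halfProb (n.choose 2) (touchingPairs n (c - 1)) m -
      (c : ℝ) ^ 2 * (1 - (m : ℝ) / (n.choose 2 : ℝ) / 2) ^ (c * (n - c)) ≤
      prob (orientedGnm n m h) (separated μ) := by
  have hp := density_mem h
  have h1 := sum_sub_le_prob_biUnion (orientedGnm n m h) (Finset.univ : Finset (Fin c))
    (fun κ => chain (monoColouring μ κ))
    (ε := (1 - (m : ℝ) / (n.choose 2 : ℝ) / 2) ^ (c * (n - c)))
    (pow_nonneg (by linarith) _) fun κ _ κ' _ hκ => prob_inter_chain_le hμ h hκ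
  simp only [prob_chain_monoColouring hμ, Finset.sum_const, Finset.card_univ, Fintype.card_fin,
    nsmul_eq_mul] at h1
  refine h1.trans (prob_mono _ ?_)
  refine Set.iUnion₂_subset fun κ _ => ?_
  exact Set.subset_biUnion_of_mem (u := fun φ => chain φ)
    (Finset.mem_coe.2 (monoColouring_mem hμ κ))

/-- The marks other than the one of colour `κ` already give `c - 1` exceptional vertices, and there
are no more only for `monoColouring μ κ`. -/
theorem le_card_filter_ne (hμ : Function.Injective μ) {φ : Fin n → Fin c}
    (hφ : φ ∈ markedColourings μ) {κ : Fin c} (hκ : φ ≠ monoColouring μ κ) :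
    c ≤ (Finset.univ.filter fun v => φ v ≠ κ).card := by
  classical
  have hφ' : ∀ i, φ (μ i) = i := by simpa [markedColourings] using hφ
  have h1 : (Finset.univ.erase κ).image μ ⊆ Finset.univ.filter fun v => φ v ≠ κ := by
    intro v hv
    obtain ⟨i, hi, rfl⟩ := Finset.mem_image.1 hv
    simpa [hφ'] using hi
  have h2 : (Finset.univ.erase κ).image μ ≠ Finset.univ.filter fun v => φ v ≠ κ := by
    intro heq
    refine hκ (funext fun v => ?_)
    by_cases hv : ∃ i, μ i = v
    · obtain ⟨i, rfl⟩ := hv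
      rw [hφ', monoColouring_mark hμ]
    · have hv' : ∀ i, μ i ≠ v := by simpa using hv
      rw [monoColouring_of_notMem hv']
      by_contra h3
      have : v ∈ Finset.univ.filter fun v => φ v ≠ κ := by simpa using h3
      rw [← heq] at this
      obtain ⟨i, -, hi⟩ := Finset.mem_image.1 this
      exact hv' i hi
  have h3 := Finset.card_lt_card (h1.ssubset_of_ne h2)
  rw [Finset.card_image_of_injective _ hμ, Finset.card_erase_of_mem (Finset.mem_univ _),
    Finset.card_univ, Fintype.card_fin] at h3
  omega

/-- Take `κ` to be a most frequent colour and use only the pairs between its class and the rest. The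
form of the bound is the one required by `sum_colouring_le`, with `y` the `n / 8`-th power. -/
theorem prob_absent_le_mul_pow {C : Type*} [Fintype C] [DecidableEq C] {d : ℕ} (hn : 96 ≤ n)
    (hC : Fintype.card C ≤ 4) (hd : d ≤ 2) (h : m ≤ n.choose 2) (forb : Fin n → Fin n → Prop)
    (φ : Fin n → C) (hforb : ∀ u v, φ u ≠ φ v → forb u v ∨ forb v u)
    (hφ : ∀ κ, d < (Finset.univ.filter fun v => φ v ≠ κ).card) :
    ∃ κ, (∃ v, φ v ≠ κ) ∧ prob (orientedGnm n m h) (absent forb) ≤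
      (1 - (m : ℝ) / (n.choose 2 : ℝ) / 2) ^ (d * n) *
      ((1 - (m : ℝ) / (n.choose 2 : ℝ) / 2) ^ (n / 8)) ^
        (Finset.univ.filter fun v => φ v ≠ κ).card := by
  have : Nonempty C := ⟨φ ⟨0, by omega⟩⟩
  obtain ⟨κ, hκ⟩ := exists_card_le_mul_card_fiber φ
  rw [Fintype.card_fin] at hκ
  have hj := hφ κ
  refine ⟨κ, ?_, ?_⟩
  · obtain ⟨v, hv⟩ := Finset.card_pos.1 (lt_of_le_of_lt (Nat.zero_le d) hj)
    exact ⟨v, (Finset.mem_filter.1 hv).2⟩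
  have hsum : (Finset.univ.filter fun v => φ v = κ).card +
      (Finset.univ.filter fun v => φ v ≠ κ).card = n := by
    have := Finset.card_filter_add_card_filter_not (s := (Finset.univ : Finset (Fin n)))
      (fun v => φ v = κ)
    rwa [Finset.card_univ, Fintype.card_fin] at this
  have h1 := prob_absent_le_of_or h forb (Finset.univ.filter fun v => φ v = κ)
    (Finset.univ.filter fun v => φ v ≠ κ) (Finset.disjoint_filter_filter_not _ _ _) (by
      intro u hu v hv
      rw [Finset.mem_filter] at hu hv
      exact hforb u v (by rw [hu.2]; exact fun e => hv.2 e.symm))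
  have hp := density_mem h
  rw [← pow_mul, ← pow_add]
  refine h1.trans (pow_le_pow_of_le_one (by linarith) (by linarith) ?_)
  have h2 := mul_add_mul_le_mul hn hsum (by nlinarith) hd hj
  rwa [mul_comm (n / 8)]

theorem prob_separated_le (hn : 96 ≤ n) (hc1 : 1 ≤ c) (hc3 : c ≤ 3) (hμ : Function.Injective μ)
    (h : m ≤ n.choose 2) :
    prob (orientedGnm n m h) (separated μ) ≤
      c * halfProb (n.choose 2) (touchingPairs n (c - 1)) m +
      c * ((1 - (m : ℝ) / (n.choose 2 : ℝ) / 2) ^ ((c - 1) * n) *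
        ((1 + ((c : ℝ) - 1) * (1 - (m : ℝ) / (n.choose 2 : ℝ) / 2) ^ (n / 8)) ^ n - 1)) := by
  classical
  have hp := density_mem h
  set P := orientedGnm n m h
  set far := (markedColourings μ).filter fun φ => ∀ κ, φ ≠ monoColouring μ κ with hfar
  have hsub : separated μ ⊆ (⋃ κ ∈ (Finset.univ : Finset (Fin c)), chain (monoColouring μ κ)) ∪
      ⋃ φ ∈ far, chain φ := by
    refine Set.iUnion₂_subset fun φ hφ => ?_
    by_cases h1 : ∃ κ, φ = monoColouring μ κ
    · obtain ⟨κ, rfl⟩ := h1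
      refine Set.subset_union_of_subset_left ?_ _
      exact Set.subset_biUnion_of_mem (u := fun κ => chain (monoColouring μ κ))
        (Finset.mem_coe.2 (Finset.mem_univ κ))
    · refine Set.subset_union_of_subset_right ?_ _
      refine Set.subset_biUnion_of_mem (u := fun φ => chain φ) (Finset.mem_coe.2 ?_)
      exact Finset.mem_filter.2 ⟨hφ, by simpa using h1⟩
  refine (prob_mono P hsub).trans ((prob_union_le _ _ _).trans (add_le_add ?_ ?_))
  · refine (prob_biUnion_le _ _ _).trans (le_of_eq ?_)
    simp only [P, prob_chain_monoColouring hμ, Finset.sum_const, Finset.card_univ,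
      Fintype.card_fin, nsmul_eq_mul]
  · refine (prob_biUnion_le _ _ _).trans ?_
    have := sum_colouring_le far (fun φ => prob P (chain φ))
      (B := (1 - (m : ℝ) / (n.choose 2 : ℝ) / 2) ^ ((c - 1) * n))
      (y := (1 - (m : ℝ) / (n.choose 2 : ℝ) / 2) ^ (n / 8))
      (pow_nonneg (by linarith) _) (pow_nonneg (by linarith) _) ?_
    · simpa only [Fintype.card_fin] using this
    · intro φ hφ
      rw [hfar, Finset.mem_filter] at hφ
      refine prob_absent_le_mul_pow hn (by rw [Fintype.card_fin]; omega) (by omega) h _ φ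
        (fun u v huv => lt_or_gt_of_ne huv) fun κ => ?_
      have := le_card_filter_ne hμ hφ.1 (hφ.2 κ)
      omega

end Chains

/-! ### The case where `b` reaches `a` -/

section Crossing

variable {n m : ℕ}

/-- No arc leaves one of the two vertex sets described by `φ`. -/
def bothClosed (φ : Fin n → Bool × Bool) : Set (Digraph (Fin n)) :=
  absent fun u v => ((φ u).1 = true ∧ (φ v).1 = false) ∨ ((φ u).2 = true ∧ (φ v).2 = false)

/-- Colourings by membership in two sets, the first of which contains `s` but not `a`, `b`,
and the second `a`, `b` but not `s`. -/
def crossingColourings (s a b : Fin n) : Finset (Fin n → Bool × Bool) :=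
  Finset.univ.filter fun φ => φ s = (true, false) ∧ φ a = (false, true) ∧ φ b = (false, true)

/-- There are closed vertex sets, one containing `s` but not `a`, `b`,
the other `a`, `b` but not `s`. -/
def crossing (s a b : Fin n) : Set (Digraph (Fin n)) :=
  ⋃ φ ∈ crossingColourings s a b, bothClosed φ

/-- With at most two exceptional vertices, `κ` must be the colour of `s` or that of `a` and `b`.
Then `a`, respectively `s`, has both directions forbidden towards the whole `κ`-class, so no edge at
all may join them. -/
theorem prob_bothClosed_le_pow (h : m ≤ n.choose 2) {s a b : Fin n} (hsa : s ≠ a) (hsb : s ≠ b)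
    (hab : a ≠ b) {φ : Fin n → Bool × Bool} (hφ : φ ∈ crossingColourings s a b)
    {κ : Bool × Bool} (hκ : (Finset.univ.filter fun v => φ v ≠ κ).card ≤ 2) :
    prob (orientedGnm n m h) (bothClosed φ) ≤ (1 - (m : ℝ) / (n.choose 2 : ℝ)) ^ (n - 2) := by
  obtain ⟨hs, ha, hb⟩ : φ s = (true, false) ∧ φ a = (false, true) ∧ φ b = (false, true) := by
    simpa [crossingColourings] using hφ
  have hp := density_mem h
  have hsum : (Finset.univ.filter fun v => φ v = κ).card +
      (Finset.univ.filter fun v => φ v ≠ κ).card = n := by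
    have := Finset.card_filter_add_card_filter_not (s := (Finset.univ : Finset (Fin n)))
      (fun v => φ v = κ)
    rwa [Finset.card_univ, Fintype.card_fin] at this
  have key : ∀ w, φ w ≠ κ → (∀ v, φ v = κ →
      ((((φ w).1 = true ∧ (φ v).1 = false) ∨ ((φ w).2 = true ∧ (φ v).2 = false)) ∧
      (((φ v).1 = true ∧ (φ w).1 = false) ∨ ((φ v).2 = true ∧ (φ w).2 = false)))) →
      prob (orientedGnm n m h) (bothClosed φ) ≤
        (1 - (m : ℝ) / (n.choose 2 : ℝ)) ^ (n - 2) := by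
    intro w hw hw2
    have h1 := prob_absent_le_of_and h
      (fun u v => ((φ u).1 = true ∧ (φ v).1 = false) ∨ ((φ u).2 = true ∧ (φ v).2 = false))
      {w} (Finset.univ.filter fun v => φ v = κ) (by simpa using hw) (by
        intro u hu v hv
        rw [Finset.mem_singleton] at hu
        subst hu
        exact hw2 v (Finset.mem_filter.1 hv).2)
    refine h1.trans (pow_le_pow_of_le_one (by linarith) (by linarith) ?_)
    rw [Finset.card_singleton]
    omega
  by_cases h1 : κ = (true, false)
  · subst h1
    exact key a (by simp [ha]) fun v hv => by simp [ha, hv]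
  by_cases h2 : κ = (false, true)
  · subst h2
    exact key s (by simp [hs]) fun v hv => by simp [hs, hv]
  exfalso
  have h3 : ({s, a, b} : Finset (Fin n)) ⊆ Finset.univ.filter fun v => φ v ≠ κ := by
    intro v hv
    simp only [Finset.mem_insert, Finset.mem_singleton] at hv
    rw [Finset.mem_filter]
    refine ⟨Finset.mem_univ _, ?_⟩
    rcases hv with rfl | rfl | rfl
    · rw [hs]; exact fun e => h1 e.symm
    · rw [ha]; exact fun e => h2 e.symm
    · rw [hb]; exact fun e => h2 e.symm
  have h4 := Finset.card_le_card h3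
  rw [Finset.card_eq_three.2 ⟨s, a, b, hsa, hsb, hab, rfl⟩] at h4
  omega

theorem prob_crossing_le (hn : 96 ≤ n) (h : m ≤ n.choose 2) {s a b : Fin n} (hsa : s ≠ a)
    (hsb : s ≠ b) (hab : a ≠ b) :
    prob (orientedGnm n m h) (crossing s a b) ≤
      4 * ((1 - (m : ℝ) / (n.choose 2 : ℝ) / 2) ^ (2 * n) *
        ((1 + 3 * (1 - (m : ℝ) / (n.choose 2 : ℝ) / 2) ^ (n / 8)) ^ n - 1)) +
      4 * ((n : ℝ) ^ 2 * (1 - (m : ℝ) / (n.choose 2 : ℝ)) ^ (n - 2) *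
        ((1 + 3 * (n : ℝ)⁻¹) ^ n - 1)) := by
  classical
  have hp := density_mem h
  have hn0 : (0 : ℝ) < n := by exact_mod_cast (by omega : 0 < n)
  have hcard : Fintype.card (Bool × Bool) = 4 := rfl
  have hcardR : ((Fintype.card (Bool × Bool) : ℕ) : ℝ) = 4 := by rw [hcard]; norm_num
  set S := crossingColourings s a b
  refine (prob_biUnion_le _ _ _).trans ?_
  -- With more than two exceptional vertices for every colour, the boundary alone is costly enough;
  -- otherwise the absent edges of `prob_bothClosed_le_pow` are used.
  rw [← Finset.sum_filter_add_sum_filter_not S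
    (fun φ => ∀ κ, 2 < (Finset.univ.filter fun v => φ v ≠ κ).card)]
  refine add_le_add ?_ ?_
  · have := sum_colouring_le (S.filter fun φ => ∀ κ, 2 < (Finset.univ.filter fun v => φ v ≠ κ).card)
      (fun φ => prob (orientedGnm n m h) (bothClosed φ))
      (B := (1 - (m : ℝ) / (n.choose 2 : ℝ) / 2) ^ (2 * n))
      (y := (1 - (m : ℝ) / (n.choose 2 : ℝ) / 2) ^ (n / 8))
      (pow_nonneg (by linarith) _) (pow_nonneg (by linarith) _) ?_
    · rw [hcardR, Fintype.card_fin] at this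
      norm_num at this ⊢
      exact this
    · intro φ hφ
      refine prob_absent_le_mul_pow hn hcard.le le_rfl h _ φ (fun u v huv => ?_)
        (Finset.mem_filter.1 hφ).2
      revert huv
      generalize φ u = x
      generalize φ v = y
      revert x y
      decide
  -- The choice `y = 1 / n` keeps `(1 + 3 / n) ^ n` bounded, and the prefactor `n ^ 2` makes up for
  -- at most two factors `1 / n`.
  · have := sum_colouring_le
      (S.filter fun φ => ¬ ∀ κ, 2 < (Finset.univ.filter fun v => φ v ≠ κ).card)
      (fun φ => prob (orientedGnm n m h) (bothClosed φ))
      (B := (n : ℝ) ^ 2 * (1 - (m : ℝ) / (n.choose 2 : ℝ)) ^ (n - 2)) (y := (n : ℝ)⁻¹)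
      (mul_nonneg (by positivity) (pow_nonneg (by linarith) _)) (by positivity) ?_
    · rw [hcardR, Fintype.card_fin] at this
      norm_num at this ⊢
      exact this
    · intro φ hφ
      obtain ⟨hφS, hφ2⟩ := Finset.mem_filter.1 hφ
      push Not at hφ2
      obtain ⟨κ, hκ⟩ := hφ2
      refine ⟨κ, ?_, ?_⟩
      · by_contra! h1
        have h2 : φ s = (true, false) ∧ φ a = (false, true) ∧ φ b = (false, true) := by
          simpa [S, crossingColourings] using hφS
        rw [h1, h1] at h2
        rw [h2.1] at h2
        simp at h2
      · refine (prob_bothClosed_le_pow h hsa hsb hab hφS hκ).trans ?_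
        rw [mul_right_comm]
        refine le_mul_of_one_le_left (pow_nonneg (by linarith) _) ?_
        have h3 : ((n : ℝ)⁻¹) ^ 2 ≤ (n : ℝ)⁻¹ ^ (Finset.univ.filter fun v => φ v ≠ κ).card :=
          pow_le_pow_of_le_one (by positivity)
            (inv_le_one_of_one_le₀ (by exact_mod_cast (by omega : 1 ≤ n))) hκ
        calc (1 : ℝ) = (n : ℝ) ^ 2 * ((n : ℝ)⁻¹) ^ 2 := by field_simp
          _ ≤ _ := by gcongr

end Crossing

/-! ### Reachability in terms of colourings -/

section Reach

variable {n : ℕ}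

theorem notReach_eq_separated (s a : Fin n) : notReach s a = separated ![s, a] := by
  classical
  ext D
  simp only [separated, Set.mem_iUnion, exists_prop]
  constructor
  · intro h
    -- The set reachable from `s` is closed, so no arc leads from colour `0` to colour `1`.
    refine ⟨fun v => if Relation.ReflTransGen D.Adj s v then 0 else 1, ?_, ?_⟩
    · simp only [markedColourings, Finset.mem_filter, Finset.mem_univ, true_and]
      intro i
      have h' : ¬ Relation.ReflTransGen D.Adj s a := h
      fin_cases i <;> simp [h', Relation.ReflTransGen.refl]
    · intro u v huv hD
      by_cases h1 : Relation.ReflTransGen D.Adj s u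
      · simp [h1, h1.tail hD] at huv
      · by_cases h2 : Relation.ReflTransGen D.Adj s v <;> simp [h1, h2] at huv
  · rintro ⟨φ, hφ, hD⟩ h
    have hφ' : ∀ i, φ (![s, a] i) = i := by simpa [markedColourings] using hφ
    have h1 := le_of_mem_chain hD h
    have h2 := hφ' 0
    have h3 := hφ' 1
    simp only [Matrix.cons_val_zero, Matrix.cons_val_one] at h2 h3
    rw [h2, h3] at h1
    exact absurd h1 (by decide)

theorem separated_subset_notReach (s a b : Fin n) :
    separated ![b, s, a] ⊆ notReach s a ∩ notReach b s := by
  intro D hD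
  simp only [separated, Set.mem_iUnion, exists_prop] at hD
  obtain ⟨φ, hφ, hD⟩ := hD
  have hφ' : ∀ i, φ (![b, s, a] i) = i := by simpa [markedColourings] using hφ
  have h0 := hφ' 0
  have h1 := hφ' 1
  have h2 := hφ' 2
  simp only [Matrix.cons_val_zero, Matrix.cons_val_one, Matrix.cons_val] at h0 h1 h2
  constructor
  · intro h
    have := le_of_mem_chain hD h
    rw [h1, h2] at this
    exact absurd this (by decide)
  · intro h
    have := le_of_mem_chain hD h
    rw [h0, h1] at this
    exact absurd this (by decide)

/-- A monotone three-colouring also forces `b ↛ a`. If `b` does reach `a`, then `s ↛ b`, and the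
sets reachable from `s` and from `b` are a crossing pair. -/
theorem notReach_inter_subset (s a b : Fin n) :
    notReach s a ∩ notReach b s ⊆ separated ![b, s, a] ∪ crossing s a b := by
  classical
  rintro D ⟨hsa, hbs⟩
  have hsa' : ¬ Relation.ReflTransGen D.Adj s a := hsa
  have hbs' : ¬ Relation.ReflTransGen D.Adj b s := hbs
  by_cases hba : Relation.ReflTransGen D.Adj b a
  · right
    have hsb : ¬ Relation.ReflTransGen D.Adj s b := fun h => hsa' (h.trans hba)
    simp only [crossing, Set.mem_iUnion, exists_prop]
    refine ⟨fun v => (decide (Relation.ReflTransGen D.Adj s v),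
      decide (Relation.ReflTransGen D.Adj b v)), ?_, ?_⟩
    · simp [crossingColourings, hsa', hbs', hba, hsb, Relation.ReflTransGen.refl]
    · intro u v huv hD
      simp only [decide_eq_true_eq, decide_eq_false_iff_not] at huv
      rcases huv with ⟨h1, h2⟩ | ⟨h1, h2⟩
      · exact h2 (h1.tail hD)
      · exact h2 (h1.tail hD)
  · left
    simp only [separated, Set.mem_iUnion, exists_prop]
    -- The nested closed sets are the vertices reachable from `b`, and those reachable from `b` or
    -- `s`.
    refine ⟨fun v => if Relation.ReflTransGen D.Adj b v then 0 else
      if Relation.ReflTransGen D.Adj s v then 1 else 2, ?_, ?_⟩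
    · simp only [markedColourings, Finset.mem_filter, Finset.mem_univ, true_and]
      intro i
      fin_cases i <;> simp [hsa', hbs', hba, Relation.ReflTransGen.refl]
    · intro u v huv hD
      by_cases h1 : Relation.ReflTransGen D.Adj b u
      · simp [h1, h1.tail hD] at huv
      by_cases h3 : Relation.ReflTransGen D.Adj b v
      · simp [h1, h3] at huv
      by_cases h2 : Relation.ReflTransGen D.Adj s u
      · simp [h1, h3, h2, h2.tail hD] at huv
      · by_cases h4 : Relation.ReflTransGen D.Adj s v
        · simp [h1, h3, h2, h4] at huv
        · simp [h1, h3, h2, h4] at huv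

end Reach

/-! ### The critical density -/

section Root

/-- The logarithm of the ratio of the two sides of the equation for the critical density. -/
noncomputable def rootFun (x : ℝ) : ℝ :=
  Real.log 3 - 2 * x * (1 - x) / (2 - x) ^ 2 - Real.log (4 - 2 * x)

theorem hasDerivAt_rootFun {x : ℝ} (hx : x < 2) :
    HasDerivAt rootFun ((x ^ 2 + 2 * x) / (2 - x) ^ 3) x := by
  have h2 : 2 - x ≠ 0 := by linarith
  have h4 : 4 - 2 * x ≠ 0 := by linarith
  have d1 : HasDerivAt (fun x : ℝ => 2 * x * (1 - x)) (2 * (1 - x) + 2 * x * (-1)) x := by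
    exact (((hasDerivAt_id x).const_mul 2).mul ((hasDerivAt_id x).const_sub 1)).congr_deriv
      (by simp)
  have d2 : HasDerivAt (fun x : ℝ => (2 - x) ^ 2) (2 * (2 - x) * (-1)) x := by
    exact (((hasDerivAt_id x).const_sub 2).pow 2).congr_deriv (by simp)
  have d3 : HasDerivAt (fun x : ℝ => Real.log (4 - 2 * x)) (-2 / (4 - 2 * x)) x := by
    have := (((hasDerivAt_id x).const_mul 2).const_sub 4).log (by simpa using h4)
    simpa using this
  have := (((d1.div d2 (pow_ne_zero 2 h2)).const_sub (Real.log 3)).sub d3)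
  refine this.congr_deriv ?_
  have h4' : 4 - 2 * x = 2 * (2 - x) := by ring
  rw [h4']
  field_simp
  ring

theorem strictMonoOn_rootFun : StrictMonoOn rootFun (Set.Icc 0 1) := by
  refine strictMonoOn_of_deriv_pos (convex_Icc 0 1) (fun x hx => ?_) fun x hx => ?_
  · exact (hasDerivAt_rootFun (by linarith [hx.2])).continuousAt.continuousWithinAt
  · rw [interior_Icc] at hx
    rw [(hasDerivAt_rootFun (by linarith [hx.2])).deriv]
    have h1 := hx.1
    have h2 : 0 < 2 - x := by linarith [hx.2]
    positivity

theorem rootFun_eq (x : ℝ) :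
    rootFun x = Real.log (3 * Real.exp (-(2 * x * (1 - x) / (2 - x) ^ 2))) -
      Real.log (4 - 2 * x) := by
  rw [Real.log_mul (by norm_num) (Real.exp_pos _).ne', Real.log_exp, rootFun]
  ring

theorem rootFun_neg_iff {x : ℝ} (hx : x < 2) :
    rootFun x < 0 ↔ 3 * Real.exp (-(2 * x * (1 - x) / (2 - x) ^ 2)) < 4 - 2 * x := by
  rw [rootFun_eq, sub_neg]
  exact Real.log_lt_log_iff (by positivity) (by linarith)

theorem rootFun_pos_iff {x : ℝ} (hx : x < 2) :
    0 < rootFun x ↔ 4 - 2 * x < 3 * Real.exp (-(2 * x * (1 - x) / (2 - x) ^ 2)) := by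
  rw [rootFun_eq, sub_pos]
  exact Real.log_lt_log_iff (by linarith) (by positivity)

theorem rootFun_lower_neg : rootFun 0.79925 < 0 := by
  rw [rootFun_neg_iff (by norm_num)]
  -- Seven Taylor terms decide the sign, although the bracketing interval has length only `0.0001`.
  have h := abs_le.1 (Real.exp_bound (x := -(2 * 0.79925 * (1 - 0.79925) / (2 - 0.79925) ^ 2))
    (by rw [abs_le]; constructor <;> norm_num) (n := 7) (by norm_num))
  have h2 := h.2
  rw [abs_of_nonpos (by norm_num)] at h2
  norm_num [Finset.sum_range_succ, Nat.factorial] at h2 ⊢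
  linarith

theorem rootFun_upper_pos : 0 < rootFun 0.79935 := by
  rw [rootFun_pos_iff (by norm_num)]
  have h := abs_le.1 (Real.exp_bound (x := -(2 * 0.79935 * (1 - 0.79935) / (2 - 0.79935) ^ 2))
    (by rw [abs_le]; constructor <;> norm_num) (n := 7) (by norm_num))
  have h2 := h.1
  rw [abs_of_nonpos (by norm_num)] at h2
  norm_num [Finset.sum_range_succ, Nat.factorial] at h2 ⊢
  linarith

theorem exists_rootFun_eq_zero : ∃ pc : ℝ, 0.79925 ≤ pc ∧ pc ≤ 0.79935 ∧ rootFun pc = 0 := by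
  have hc : ContinuousOn rootFun (Set.Icc 0.79925 0.79935) := fun x hx =>
    (hasDerivAt_rootFun (by linarith [hx.2])).continuousAt.continuousWithinAt
  obtain ⟨x, hx, h⟩ := intermediate_value_Icc (by norm_num) hc
    ⟨rootFun_lower_neg.le, rootFun_upper_pos.le⟩
  exact ⟨x, hx.1, hx.2, h⟩

end Root

/-! ### Error terms and finite bounds -/

section Limits

open Filter Topology

theorem choose_two_sub_choose_two (n : ℕ) (hn : 2 ≤ n) :
    touchingPairs n 1 = n - 1 ∧ touchingPairs n 2 = 2 * n - 3 := by
  obtain ⟨k, rfl⟩ : ∃ k, n = k + 2 := ⟨n - 2, by omega⟩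
  have h1 : (k + 2).choose 2 = (k + 1).choose 2 + (k + 1) := by
    rw [Nat.choose_succ_succ' (k + 1) 1, Nat.choose_one_right, add_comm]
  have h2 : (k + 1).choose 2 = k.choose 2 + k := by
    rw [Nat.choose_succ_succ' k 1, Nat.choose_one_right, add_comm]
  have e1 : k + 2 - 1 = k + 1 := rfl
  have e2 : k + 2 - 2 = k := rfl
  unfold touchingPairs
  rw [e1, e2]
  omega

theorem tendsto_one_add_pow_sub_one {a : ℝ} (ha : 0 ≤ a) {y : ℕ → ℝ} (hy : ∀ n, 0 ≤ y n)
    (h : Tendsto (fun n : ℕ => n * y n) atTop (𝓝 0)) :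
    Tendsto (fun n : ℕ => (1 + a * y n) ^ n - 1) atTop (𝓝 0) := by
  have h1 : Tendsto (fun n : ℕ => Real.exp (a * (n * y n)) - 1) atTop (𝓝 0) := by
    have := ((Real.continuous_exp.tendsto _).comp (h.const_mul a)).sub_const 1
    simpa using this
  refine squeeze_zero (fun n => ?_) (fun n => ?_) h1
  · rw [sub_nonneg]
    exact one_le_pow₀ (by linarith [mul_nonneg ha (hy n)])
  · have h2 : (1 + a * y n) ^ n ≤ Real.exp (a * y n) ^ n := by
      refine pow_le_pow_left₀ (by linarith [mul_nonneg ha (hy n)]) ?_ n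
      linarith [Real.add_one_le_exp (a * y n)]
    rw [← Real.exp_nat_mul] at h2
    have e : (n : ℝ) * (a * y n) = a * (n * y n) := by ring
    rw [e] at h2
    linarith

theorem tendsto_mul_pow_div {q : ℝ} {y : ℕ → ℝ} (hq : q < 1) (hy0 : ∀ n, 0 ≤ y n)
    (hy : Tendsto y atTop (𝓝 q)) {d : ℕ} (hd : 0 < d) (a : ℕ) :
    Tendsto (fun n : ℕ => (n : ℝ) ^ a * y n ^ (n / d)) atTop (𝓝 0) := by
  -- A fixed ratio strictly between `max q 0` and `1` eventually dominates `y n`; the maximum keeps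
  -- it positive for the division below.
  obtain ⟨q', hq'1, hq'2⟩ := exists_between (max_lt hq zero_lt_one)
  have hq'0 : 0 < q' := (le_max_right _ _).trans_lt hq'1
  have h1 : Tendsto (fun k : ℕ => (k : ℝ) ^ a * q' ^ k) atTop (𝓝 0) :=
    tendsto_pow_const_mul_const_pow_of_abs_lt_one a (by rwa [abs_of_pos hq'0])
  have h2 : Tendsto (fun n : ℕ => n / d + 1) atTop atTop :=
    (tendsto_add_atTop_nat 1).comp (Nat.tendsto_div_const_atTop hd.ne')
  have h3 := (h1.comp h2).const_mul ((d : ℝ) ^ a / q')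
  rw [mul_zero] at h3
  refine squeeze_zero' (Eventually.of_forall fun n => ?_) ?_ h3
  · have := hy0 n
    positivity
  · filter_upwards [hy.eventually_le_const ((le_max_left _ _).trans_lt hq'1)] with n hn
    have h4 : (n : ℝ) ≤ d * ((n / d + 1 : ℕ) : ℝ) := by
      exact_mod_cast (Nat.lt_mul_div_succ n hd).le
    simp only [Function.comp]
    calc (n : ℝ) ^ a * y n ^ (n / d) ≤ (d * ((n / d + 1 : ℕ) : ℝ)) ^ a * q' ^ (n / d) := by
          have := hy0 n
          gcongr
      _ = _ := by
          rw [mul_pow, pow_succ q']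
          field_simp

theorem injective_pair {V : Type*} {s a : V} (h : s ≠ a) : Function.Injective ![s, a] := by
  intro i j
  fin_cases i <;> fin_cases j <;> simp [h, h.symm]

theorem injective_triple {V : Type*} {s a b : V} (h1 : s ≠ a) (h2 : s ≠ b) (h3 : a ≠ b) :
    Function.Injective ![b, s, a] := by
  intro i j
  fin_cases i <;> fin_cases j <;> simp [h1, h1.symm, h2, h2.symm, h3, h3.symm]

theorem prob_notReach_mem (n : ℕ) (k : ℕ) (hn : 96 ≤ n) (h : k ≤ n.choose 2) {q : ℝ}
    (hq : q = 1 - (k : ℝ) / (n.choose 2 : ℝ) / 2) {s a : Fin n} (hsa : s ≠ a) :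
    2 * halfProb (n.choose 2) (n - 1) k - 4 * q ^ (2 * (n - 2)) ≤
      prob (orientedGnm n k h) (notReach s a) ∧
    prob (orientedGnm n k h) (notReach s a) ≤ 2 * halfProb (n.choose 2) (n - 1) k +
      2 * (q ^ n * ((1 + 1 * q ^ (n / 8)) ^ n - 1)) := by
  have h1 := le_prob_separated (injective_pair hsa) h
  have h2 := prob_separated_le hn (by norm_num) (by norm_num) (injective_pair hsa) h
  rw [← hq] at h1 h2
  rw [← notReach_eq_separated, (choose_two_sub_choose_two n (by omega)).1] at h1 h2
  norm_num at h1 h2 ⊢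
  exact ⟨by linarith, by linarith⟩

theorem prob_inter_mem (n : ℕ) (k : ℕ) (hn : 96 ≤ n) (h : k ≤ n.choose 2) {q : ℝ}
    (hq : q = 1 - (k : ℝ) / (n.choose 2 : ℝ) / 2) {s a b : Fin n} (hsa : s ≠ a) (hsb : s ≠ b)
    (hab : a ≠ b) :
    3 * halfProb (n.choose 2) (2 * n - 3) k - 9 * q ^ (3 * (n - 3)) ≤
      prob (orientedGnm n k h) (notReach s a ∩ notReach b s) ∧
    prob (orientedGnm n k h) (notReach s a ∩ notReach b s) ≤
      3 * halfProb (n.choose 2) (2 * n - 3) k +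
      3 * (q ^ (2 * n) * ((1 + 2 * q ^ (n / 8)) ^ n - 1)) +
      (4 * (q ^ (2 * n) * ((1 + 3 * q ^ (n / 8)) ^ n - 1)) +
      4 * ((n : ℝ) ^ 2 * (1 - (k : ℝ) / (n.choose 2 : ℝ)) ^ (n - 2) *
        ((1 + 3 * (n : ℝ)⁻¹) ^ n - 1))) := by
  have h1 := le_prob_separated (injective_triple hsa hsb hab) h
  have h2 := prob_separated_le hn (by norm_num) (by norm_num) (injective_triple hsa hsb hab) h
  have h3 := prob_crossing_le hn h hsa hsb hab
  rw [← hq] at h1 h2 h3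
  rw [(choose_two_sub_choose_two n (by omega)).2] at h1 h2
  have h4 := prob_mono (orientedGnm n k h) (separated_subset_notReach s a b)
  have h5 := prob_mono (orientedGnm n k h) (notReach_inter_subset s a b)
  have h6 := prob_union_le (orientedGnm n k h) (separated ![b, s, a]) (crossing s a b)
  have e : (((3 : ℕ) : ℝ) - 1) = 2 := by norm_num
  rw [e] at h2
  norm_num at h1 h2
  exact ⟨by linarith, by linarith⟩

end Limits

/-! ### Limits of the probabilities and the sign of the covariance -/

section Main

open Filter Topology

theorem tendsto_sub_div_id (a b : ℕ) :
    Tendsto (fun n : ℕ => ((a * n - b : ℕ) : ℝ) / n) atTop (𝓝 a) := by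
  have h : Tendsto (fun n : ℕ => (a : ℝ) - b * (n : ℝ)⁻¹) atTop (𝓝 (a - b * 0)) :=
    (tendsto_inv_atTop_nhds_zero_nat.const_mul _).const_sub _
  rw [mul_zero, sub_zero] at h
  by_cases ha : a = 0
  · subst ha
    simp
  refine h.congr' ?_
  filter_upwards [eventually_ge_atTop (b + 1)] with n hn
  have h1 : (0 : ℝ) < n := by exact_mod_cast (by omega : 0 < n)
  have h2 : b ≤ a * n := (by omega : b ≤ n).trans (Nat.le_mul_of_pos_left n (Nat.pos_of_ne_zero ha))
  rw [Nat.cast_sub h2]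
  push_cast
  field_simp

variable {p : ℝ} {m : ℕ → ℕ}

/-- The normalization is `Q n = q n ^ n` with the actual density of `m n`. The convergence of that
density to `p` has no rate, so `(1 - p / 2) ^ n` could not replace it. The bounds do not depend on
the vertices, which gives uniformity in `s`, `a`, `b`. -/
theorem exists_prob_bounds (hp0 : 0 < p) (hp1 : p ≤ 1) (hm : ∀ n, m n ≤ n.choose 2)
    (hlim : Tendsto (fun n : ℕ => (m n : ℝ) / (n.choose 2 : ℝ)) atTop (𝓝 p)) :
    ∃ Q lo hi lo' hi' : ℕ → ℝ,
      (∀ n, 0 < Q n) ∧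
      Tendsto lo atTop (𝓝 (2 * (Real.exp (-(p * (1 - p) / (2 - p) ^ 2)) / (1 - p / 2)))) ∧
      Tendsto hi atTop (𝓝 (2 * (Real.exp (-(p * (1 - p) / (2 - p) ^ 2)) / (1 - p / 2)))) ∧
      Tendsto lo' atTop
        (𝓝 (3 * (Real.exp (-(p * (1 - p) / (2 - p) ^ 2)) ^ 4 / (1 - p / 2) ^ 3))) ∧
      Tendsto hi' atTop
        (𝓝 (3 * (Real.exp (-(p * (1 - p) / (2 - p) ^ 2)) ^ 4 / (1 - p / 2) ^ 3))) ∧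
      ∀ᶠ n in atTop,
        (∀ s a : Fin n, s ≠ a →
          lo n * Q n ≤ prob (orientedGnm n (m n) (hm n)) (notReach s a) ∧
          prob (orientedGnm n (m n) (hm n)) (notReach s a) ≤ hi n * Q n) ∧
        (∀ s a b : Fin n, s ≠ a → s ≠ b → a ≠ b →
          lo' n * Q n ^ 2 ≤ prob (orientedGnm n (m n) (hm n)) (notReach s a ∩ notReach b s) ∧
          prob (orientedGnm n (m n) (hm n)) (notReach s a ∩ notReach b s) ≤ hi' n * Q n ^ 2) := by
  set r : ℕ → ℝ := fun n => (m n : ℝ) / (n.choose 2 : ℝ) with hr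
  set q : ℕ → ℝ := fun n => 1 - r n / 2 with hq
  set α := Real.exp (-(p * (1 - p) / (2 - p) ^ 2)) with hα
  have hr01 : ∀ n, 0 ≤ r n ∧ r n ≤ 1 := fun n => density_mem (hm n)
  have hq0 : ∀ n, 0 < q n := fun n => by simp only [hq]; linarith [(hr01 n).2]
  have hq1 : ∀ n, q n ≤ 1 := fun n => by simp only [hq]; linarith [(hr01 n).1]
  have hqlim : Tendsto q atTop (𝓝 (1 - p / 2)) := (hlim.div_const 2).const_sub 1
  have hql0 : 0 < 1 - p / 2 := by linarith
  have hql1 : 1 - p / 2 < 1 := by linarith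
  have hA0 := tendsto_halfProb_div_pow hp0 hp1 hm hlim (k := fun n => n - 1) (c := 1) (by
    simpa using tendsto_sub_div_id 1 1)
  have hB0 := tendsto_halfProb_div_pow hp0 hp1 hm hlim (k := fun n => 2 * n - 3) (c := 2) (by
    simpa using tendsto_sub_div_id 2 3)
  have hA : Tendsto (fun n : ℕ => halfProb (n.choose 2) (n - 1) (m n) / q n ^ n) atTop
      (𝓝 (α / (1 - p / 2))) := by
    have h1 := hA0.div hqlim hql0.ne'
    rw [one_pow, mul_one] at h1
    refine h1.congr' ?_
    filter_upwards [eventually_ge_atTop 1] with n hn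
    simp only [Pi.div_apply]
    rw [div_div, ← pow_succ, Nat.sub_add_cancel hn]
  have hB : Tendsto (fun n : ℕ => halfProb (n.choose 2) (2 * n - 3) (m n) / q n ^ (2 * n)) atTop
      (𝓝 (α ^ 4 / (1 - p / 2) ^ 3)) := by
    have h1 := hB0.div (hqlim.pow 3) (pow_pos hql0 3).ne'
    have e : Real.exp (-(p * (1 - p) / (2 - p) ^ 2 * 2 ^ 2)) = α ^ 4 := by
      rw [hα, ← Real.exp_nat_mul]
      congr 1
      push_cast
      ring
    rw [e] at h1
    refine h1.congr' ?_
    filter_upwards [eventually_ge_atTop 2] with n hn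
    simp only [Pi.div_apply]
    rw [div_div, ← pow_add, Nat.sub_add_cancel (by omega)]
  have hy : Tendsto (fun n : ℕ => (n : ℝ) * q n ^ (n / 8)) atTop (𝓝 0) := by
    simpa using tendsto_mul_pow_div hql1 (fun n => (hq0 n).le) hqlim (d := 8) (by norm_num) 1
  have herr : ∀ a : ℝ, 0 ≤ a →
      Tendsto (fun n : ℕ => (1 + a * q n ^ (n / 8)) ^ n - 1) atTop (𝓝 0) := fun a ha =>
    tendsto_one_add_pow_sub_one ha (fun n => (pow_pos (hq0 n) _).le) hy
  have hqn : Tendsto (fun n : ℕ => q n ^ n) atTop (𝓝 0) := by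
    simpa using tendsto_mul_pow_div hql1 (fun n => (hq0 n).le) hqlim (d := 1) one_pos 0
  have hlow : ∀ a : ℝ, ∀ k : ℕ, Tendsto (fun n => a * (q n ^ n / q n ^ k)) atTop (𝓝 0) := by
    intro a k
    have := (hqn.div (hqlim.pow k) (pow_pos hql0 k).ne').const_mul a
    rwa [zero_div, mul_zero] at this
  have hη0 : ∀ n, 0 ≤ (1 - r n) / q n ^ 2 := fun n =>
    div_nonneg (by linarith [(hr01 n).2]) (sq_nonneg _)
  have hη1 : ∀ n, (1 - r n) / q n ^ 2 ≤ 1 := fun n => by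
    refine div_le_one_of_le₀ ?_ (sq_nonneg _)
    simp only [hq]
    nlinarith [sq_nonneg (r n)]
  have hηlim : Tendsto (fun n => (1 - r n) / q n ^ 2) atTop (𝓝 ((1 - p) / (1 - p / 2) ^ 2)) :=
    (hlim.const_sub 1).div (hqlim.pow 2) (pow_pos hql0 2).ne'
  -- As `(1 - p / 2) ^ 2 = 1 - p + p ^ 2 / 4`, forbidding edges outright at one vertex is
  -- exponentially more costly than forbidding one direction at two vertices. This uses `p > 0`.
  have hηl : (1 - p) / (1 - p / 2) ^ 2 < 1 := by
    rw [div_lt_one (pow_pos hql0 2)]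
    nlinarith [sq_pos_of_pos hp0]
  have hexp : Tendsto (fun n : ℕ => (n : ℝ) ^ 2 * ((1 - r n) / q n ^ 2) ^ (n - 2)) atTop
      (𝓝 0) := by
    refine squeeze_zero' (Eventually.of_forall fun n => ?_) ?_
      (tendsto_mul_pow_div hηl hη0 hηlim (d := 2) two_pos 2)
    · exact mul_nonneg (by positivity) (pow_nonneg (hη0 n) _)
    · filter_upwards [eventually_ge_atTop 4] with n hn
      exact mul_le_mul_of_nonneg_left (pow_le_pow_of_le_one (hη0 n) (hη1 n) (by omega))
        (by positivity)
  have hcross : Tendsto (fun n : ℕ => 4 * ((n : ℝ) ^ 2 * ((1 - r n) / q n ^ 2) ^ (n - 2) /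
      q n ^ 4 * Real.exp 3)) atTop (𝓝 0) := by
    have := ((hexp.div (hqlim.pow 4) (pow_pos hql0 4).ne').mul_const (Real.exp 3)).const_mul 4
    rwa [zero_div, zero_mul, mul_zero] at this
  refine ⟨fun n => q n ^ n,
    fun n => 2 * (halfProb (n.choose 2) (n - 1) (m n) / q n ^ n) - 4 * (q n ^ n / q n ^ 4),
    fun n => 2 * (halfProb (n.choose 2) (n - 1) (m n) / q n ^ n) +
      2 * ((1 + 1 * q n ^ (n / 8)) ^ n - 1),
    fun n => 3 * (halfProb (n.choose 2) (2 * n - 3) (m n) / q n ^ (2 * n)) -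
      9 * (q n ^ n / q n ^ 9),
    fun n => 3 * (halfProb (n.choose 2) (2 * n - 3) (m n) / q n ^ (2 * n)) +
      3 * ((1 + 2 * q n ^ (n / 8)) ^ n - 1) + (4 * ((1 + 3 * q n ^ (n / 8)) ^ n - 1) +
      4 * ((n : ℝ) ^ 2 * ((1 - r n) / q n ^ 2) ^ (n - 2) / q n ^ 4 * Real.exp 3)),
    fun n => pow_pos (hq0 n) n, ?_, ?_, ?_, ?_, ?_⟩
  · simpa using (hA.const_mul 2).sub (hlow 4 4)
  · simpa using (hA.const_mul 2).add ((herr 1 (by norm_num)).const_mul 2)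
  · simpa using (hB.const_mul 3).sub (hlow 9 9)
  · simpa using ((hB.const_mul 3).add ((herr 2 (by norm_num)).const_mul 3)).add
      (((herr 3 (by norm_num)).const_mul 4).add hcross)
  filter_upwards [eventually_ge_atTop 96] with n hn
  have hqn0 := hq0 n
  have hQ2 : (q n ^ n) ^ 2 = q n ^ (2 * n) := by rw [← pow_mul, mul_comm]
  refine ⟨fun s a hsa => ?_, fun s a b hsa hsb hab => ?_⟩
  · have h1 := prob_notReach_mem n (m n) hn (hm n) (q := q n) rfl hsa
    have e : q n ^ (2 * (n - 2)) = q n ^ n / q n ^ 4 * q n ^ n := by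
      rw [div_mul_eq_mul_div, eq_div_iff (by positivity), ← pow_add, ← pow_add]
      congr 1
      omega
    rw [e] at h1
    refine ⟨(le_of_eq ?_).trans h1.1, h1.2.trans (le_of_eq ?_)⟩
    · field_simp
    · field_simp
  · have h1 := prob_inter_mem n (m n) hn (hm n) (q := q n) rfl hsa hsb hab
    have e : q n ^ (3 * (n - 3)) = q n ^ n / q n ^ 9 * q n ^ (2 * n) := by
      rw [div_mul_eq_mul_div, eq_div_iff (by positivity), ← pow_add, ← pow_add]
      congr 1
      omega
    rw [e] at h1
    have hr2 := hr01 n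
    have h2 : (1 + 3 * (n : ℝ)⁻¹) ^ n - 1 ≤ Real.exp 3 := by
      have h3 : (1 + 3 * (n : ℝ)⁻¹) ^ n ≤ Real.exp (3 * (n : ℝ)⁻¹) ^ n := by
        refine pow_le_pow_left₀ (by positivity) ?_ n
        linarith [Real.add_one_le_exp (3 * (n : ℝ)⁻¹)]
      have hn0 : (n : ℝ) ≠ 0 := by exact_mod_cast (by omega : n ≠ 0)
      have e3 : (n : ℝ) * (3 * (n : ℝ)⁻¹) = 3 := by field_simp
      rw [← Real.exp_nat_mul, e3] at h3
      linarith
    have h4 : (n : ℝ) ^ 2 * (1 - r n) ^ (n - 2) * ((1 + 3 * (n : ℝ)⁻¹) ^ n - 1) ≤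
        (n : ℝ) ^ 2 * ((1 - r n) / q n ^ 2) ^ (n - 2) / q n ^ 4 * Real.exp 3 *
          q n ^ (2 * n) := by
      have e4 : (n : ℝ) ^ 2 * ((1 - r n) / q n ^ 2) ^ (n - 2) / q n ^ 4 * Real.exp 3 *
          q n ^ (2 * n) = (n : ℝ) ^ 2 * (1 - r n) ^ (n - 2) * Real.exp 3 := by
        have : q n ^ (2 * n) = (q n ^ 2) ^ (n - 2) * q n ^ 4 := by
          rw [← pow_mul, ← pow_add]
          congr 1
          omega
        rw [this, div_pow]
        field_simp
      rw [e4]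
      exact mul_le_mul_of_nonneg_left h2
        (mul_nonneg (by positivity) (pow_nonneg (by linarith) _))
    rw [hQ2]
    have e5 : halfProb (n.choose 2) (2 * n - 3) (m n) / q n ^ (2 * n) * q n ^ (2 * n) =
        halfProb (n.choose 2) (2 * n - 3) (m n) := div_mul_cancel₀ _ (by positivity)
    refine ⟨(le_of_eq ?_).trans h1.1, h1.2.trans ?_⟩
    · rw [sub_mul, mul_assoc 3, e5]
      ring
    · simp only [add_mul, mul_assoc 3 (halfProb _ _ _ / _), e5]
      linarith

theorem eventually_cov_sign (hp0 : 0 < p) (hp1 : p ≤ 1) (hm : ∀ n, m n ≤ n.choose 2)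
    (hlim : Tendsto (fun n : ℕ => (m n : ℝ) / (n.choose 2 : ℝ)) atTop (𝓝 p)) :
    (rootFun p < 0 → ∀ᶠ n in atTop, ∀ s a b : Fin n, s ≠ a → s ≠ b → a ≠ b →
      cov (orientedGnm n (m n) (hm n)) (notReach s a) (notReach b s) < 0) ∧
    (0 < rootFun p → ∀ᶠ n in atTop, ∀ s a b : Fin n, s ≠ a → s ≠ b → a ≠ b →
      0 < cov (orientedGnm n (m n) (hm n)) (notReach s a) (notReach b s)) := by
  obtain ⟨Q, lo, hi, lo', hi', hQ, hlo, hhi, hlo', hhi', hbd⟩ :=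
    exists_prob_bounds hp0 hp1 hm hlim
  rw [rootFun_neg_iff (by linarith), rootFun_pos_iff (by linarith)]
  have e : Real.exp (-(2 * p * (1 - p) / (2 - p) ^ 2)) =
      Real.exp (-(p * (1 - p) / (2 - p) ^ 2)) ^ 2 := by
    rw [← Real.exp_nat_mul]
    congr 1
    push_cast
    ring
  rw [e]
  set α := Real.exp (-(p * (1 - p) / (2 - p) ^ 2))
  have hα : 0 < α := Real.exp_pos _
  have hq : 0 < 1 - p / 2 := by linarith
  -- The limit of the covariance divided by `Q n ^ 2` is a positive factor times the difference of
  -- the two sides of the critical equation.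
  have hfac : 3 * (α ^ 4 / (1 - p / 2) ^ 3) - (2 * (α / (1 - p / 2))) ^ 2 =
      α ^ 2 / (1 - p / 2) ^ 3 * (3 * α ^ 2 - (4 - 2 * p)) := by
    field_simp
    ring
  have hc : 0 < α ^ 2 / (1 - p / 2) ^ 3 := by positivity
  constructor
  · intro h
    have h1 := hhi'.sub (hlo.pow 2)
    rw [hfac] at h1
    filter_upwards [hbd, h1.eventually_lt_const (mul_neg_of_pos_of_neg hc (by linarith)),
      hlo.eventually_const_lt (show 0 < 2 * (α / (1 - p / 2)) by positivity)]
      with n ⟨h2, h3⟩ h4 h5 s a b hsa hsb hab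
    have h6 := (h2 s a hsa).1
    have h7 := (h2 b s hsb.symm).1
    have h8 := (h3 s a b hsa hsb hab).2
    have h9 := mul_le_mul h6 h7 (mul_pos h5 (hQ n)).le (prob_nonneg _ _)
    have h10 : (hi' n - lo n ^ 2) * Q n ^ 2 < 0 :=
      mul_neg_of_neg_of_pos h4 (pow_pos (hQ n) 2)
    rw [cov]
    linarith
  · intro h
    have h1 := hlo'.sub (hhi.pow 2)
    rw [hfac] at h1
    filter_upwards [hbd, h1.eventually_const_lt (mul_pos hc (by linarith))]
      with n ⟨h2, h3⟩ h4 s a b hsa hsb hab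
    have h6 := (h2 s a hsa).2
    have h7 := (h2 b s hsb.symm).2
    have h8 := (h3 s a b hsa hsb hab).1
    have h9 := mul_le_mul h6 h7 (prob_nonneg _ _) ((prob_nonneg _ _).trans h6)
    have h10 : 0 < (lo' n - hi n ^ 2) * Q n ^ 2 := mul_pos h4 (pow_pos (hQ n) 2)
    rw [cov]
    linarith

end Main

end RandomOrientation

theorem theorem2p2 :
    ∃ pc : ℝ,
      -- `pc` is the unique root in `[0,1]`, and it lies in `(0,1)`
      (0 < pc ∧ pc < 1) ∧
      (∀ x : ℝ, 0 ≤ x → x ≤ 1 →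
        (3 * Real.exp (-(2 * x * (1 - x) / (2 - x) ^ 2)) = 4 - 2 * x ↔ x = pc)) ∧
      -- `pc ≈ 0.7993`, correct to the four decimals shown
      |pc - 0.7993| ≤ 0.00005 ∧
      ∀ (p : ℝ) (m : ℕ → ℕ) (hm : ∀ n, m n ≤ n.choose 2),
        0 < p → p ≤ 1 →
        Filter.Tendsto (fun n : ℕ => (m n : ℝ) / (n.choose 2 : ℝ)) Filter.atTop (nhds p) →
        (p < pc → ∀ᶠ n in Filter.atTop, ∀ s a b : Fin n, s ≠ a → s ≠ b → a ≠ b →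
          RandomOrientation.cov (RandomOrientation.orientedGnm n (m n) (hm n))
            (RandomOrientation.notReach s a) (RandomOrientation.notReach b s) < 0) ∧
        (pc < p → ∀ᶠ n in Filter.atTop, ∀ s a b : Fin n, s ≠ a → s ≠ b → a ≠ b →
          0 < RandomOrientation.cov (RandomOrientation.orientedGnm n (m n) (hm n))
            (RandomOrientation.notReach s a) (RandomOrientation.notReach b s)) := by
  obtain ⟨pc, h1, h2, h0⟩ := RandomOrientation.exists_rootFun_eq_zero
  have hmono := RandomOrientation.strictMonoOn_rootFun
  have hpc : pc ∈ Set.Icc (0 : ℝ) 1 := ⟨by linarith, by linarith⟩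
  refine ⟨pc, ⟨by linarith, by linarith⟩, fun x hx0 hx1 => ?_, ?_, ?_⟩
  · have hx2 : x < 2 := by linarith
    rw [← hmono.injOn.eq_iff ⟨hx0, hx1⟩ hpc, h0]
    constructor
    · intro h
      refine le_antisymm (not_lt.1 fun h' => ?_) (not_lt.1 fun h' => ?_)
      · linarith [(RandomOrientation.rootFun_pos_iff hx2).1 h']
      · linarith [(RandomOrientation.rootFun_neg_iff hx2).1 h']
    · intro h
      refine le_antisymm (not_lt.1 fun h' => ?_) (not_lt.1 fun h' => ?_)
      · linarith [(RandomOrientation.rootFun_pos_iff hx2).2 h']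
      · linarith [(RandomOrientation.rootFun_neg_iff hx2).2 h']
  · rw [abs_le]
    constructor <;> norm_num at h1 h2 ⊢ <;> linarith
  · intro p m hm hp0 hp1 hlim
    have hp : p ∈ Set.Icc (0 : ℝ) 1 := ⟨hp0.le, hp1⟩
    obtain ⟨hneg, hpos⟩ := RandomOrientation.eventually_cov_sign hp0 hp1 hm hlim
    exact ⟨fun h => hneg (h0 ▸ hmono hp hpc h), fun h => hpos (h0 ▸ hmono hpc hp h)⟩
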